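/- **Setting.** Let $n,d\ge 2$. Let $x_1,\dots,x_n\in\mathbb R^d$ be i.i.d. zero-mean $\frac{\sigma^2}{d}$-sub-Gaussian vectors, i.e. $\mathbb E\exp(t\langle u,x_i\rangle)\le \exp(\frac{\sigma^2t^2}{2d})$ for every unit vector $u$ and every $t\in\mathbb R$, with covariance matrix $\Sigma=(\sigma_{jk})$. Assume $\Sigma\in\mathcal G_q(s)$ for some $0\le q<1$, i.e. $\max_j\sum_{k}|\sigma_{jk}|^q\le s$ (with $0^0=0$). Given parameters $r,\varepsilon,\delta,\gamma$, the private covariance estimator $\ddot\Sigma$ is defined as follows. 1. Clip: $\bar x_i=x_i\min\{1,r/\|x_i\|_2\}$, and put $\hat\Sigma=\frac1n\sum_{i=1}^n\bar x_i\bar x_i^T$. 2. Add noise: $\dot\Sigma=\hat\Sigma+N$, where $N$ is a symmetric random matrix, independent of the data, whose entries on and above the diagonal are i.i.d. $\mathcal N\bigl(0,\frac{32r^4\log(2.5/\delta)}{n^2\varepsilon^2}\bigr)$. 3. Hard-threshold: $\ddot\sigma_{jk}=\dot\sigma_{jk}\,I[|\dot\sigma_{jk}|>\mathrm{Thres}]$,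 where $\mathrm{Thres}=\gamma\sqrt{\frac{\log d}{n}}+\frac{4r^2\sqrt{2\log(1.25/\delta)}\sqrt{\log d}}{n\varepsilon}$. Let $\|A\|_\infty=\sup_{y\ne0}\|Ay\|_\infty/\|y\|_\infty$ and $B=\frac{\log d\,\log(1/\delta)\,r^4}{n\varepsilon^2}$. **Lemma.** There are absolute constants $c,a_0>0$ with the following property. Let $\sigma,\varepsilon_0,K>0$ and $\delta_0<1$. There is $\gamma_0>0$, depending only on $\sigma,\varepsilon_0,\delta_0,K$, such that for every constant $\gamma\ge\gamma_0$ there is $C>0$, depending only on $\sigma,\varepsilon_0,\delta_0,K,\gamma$, such that for all $n,d\ge2$, all $q\in[0,1)$ and $s$, all $0<\varepsilon\le\varepsilon_0$ and $0<\delta\le\delta_0$, every clipping radius $r\ge a_0\sigma\sqrt{\log n}$ with $\frac{r^4\log(1/\delta)}{\varepsilon^2}\le Kn$, and every law of the $x_i$ as above, $\|\ddot\Sigma-\Sigma\|_\infty^2$ is integrable and $$\mathbb E\|\ddot\Sigma-\Sigma\|_\infty^2\le C\left(s^2B^{1-q}+B\right),$$ where the expectation is over the data and the noise; moreover, with probability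 at least $1-d^{-c}$ over the data and the noise, $$\|\ddot\Sigma-\Sigma\|_\infty^2\le C\left(s^2B^{1-q}+B\right).$$ -/

import Mathlib

open MeasureTheory ProbabilityTheory

noncomputable section

namespace PrivCov

/-- The operator norm of `A` acting on `ℝ^d` with the sup norm:
`sup_{y ≠ 0} ‖A y‖_∞ / ‖y‖_∞` (the space `Fin d → ℝ` carries the sup norm). -/
def infNorm {d : ℕ} (A : Matrix (Fin d) (Fin d) ℝ) : ℝ :=
  ‖LinearMap.toContinuousLinearMap (Matrix.mulVecLin A)‖

/-- A law on `ℝ^d` is `v`-sub-Gaussian when each one-dimensional projection onto a unit vector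
`u` satisfies `E exp (t ⟨u, X⟩) ≤ exp (v t ^ 2 / 2)` for all real `t`; in particular it has
mean zero. -/
def IsSubGaussianLaw {d : ℕ} (P : Measure (EuclideanSpace ℝ (Fin d))) (v : NNReal) : Prop :=
  ∀ u : EuclideanSpace ℝ (Fin d), ‖u‖ = 1 →
    HasSubgaussianMGF (fun x : EuclideanSpace ℝ (Fin d) => inner ℝ u x) v P

/-- The covariance matrix of a law on `ℝ^d`. -/
def covMatrix {d : ℕ} (P : Measure (EuclideanSpace ℝ (Fin d))) : Matrix (Fin d) (Fin d) ℝ :=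
  Matrix.of fun i j =>
    covariance (fun x : EuclideanSpace ℝ (Fin d) => x i)
      (fun x : EuclideanSpace ℝ (Fin d) => x j) P

/-- The class `G_q(s)` of `s`-approximately sparse matrices: `∑_j |A i j| ^ q ≤ s` for each row.
The sum runs over the nonzero entries, so for `q = 0` it counts them (`0 ^ 0 = 0`). -/
def SparseClass (d : ℕ) (q s : ℝ) : Set (Matrix (Fin d) (Fin d) ℝ) :=
  {A | ∀ i, (∑ j, if A i j = 0 then 0 else |A i j| ^ q) ≤ s}

/-- Clipping to the Euclidean ball of radius `r`: `x * min {1, r / ‖x‖₂}`. -/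
def clip {d : ℕ} (r : ℝ) (x : EuclideanSpace ℝ (Fin d)) : EuclideanSpace ℝ (Fin d) :=
  min 1 (r / ‖x‖) • x

/-- The empirical second-moment matrix `(1/n) ∑ x̄_i x̄_iᵀ` of the clipped records. -/
def clippedCov {n d : ℕ} (r : ℝ) (x : Fin n → EuclideanSpace ℝ (Fin d)) :
    Matrix (Fin d) (Fin d) ℝ :=
  Matrix.of fun j k => (1 / (n : ℝ)) * ∑ i, clip r (x i) j * clip r (x i) k

/-- The variance `32 r⁴ log(2.5/δ) / (n² ε²)` of the Gaussian noise. -/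
def noiseVar (n : ℕ) (r ε δ : ℝ) : ℝ :=
  32 * r ^ 4 * Real.log (2.5 / δ) / ((n : ℝ) ^ 2 * ε ^ 2)

/-- The threshold `γ √(log d / n) + 4 r² √(2 log(1.25/δ)) √(log d) / (n ε)`. -/
def thres (n d : ℕ) (γ r ε δ : ℝ) : ℝ :=
  γ * Real.sqrt (Real.log d / n) +
    4 * r ^ 2 * Real.sqrt (2 * Real.log (1.25 / δ)) * Real.sqrt (Real.log d) / (n * ε)

/-- Entrywise hard thresholding: entries of absolute value at most `t` are set to `0`. -/
def hardThreshold {d : ℕ} (t : ℝ) (A : Matrix (Fin d) (Fin d) ℝ) : Matrix (Fin d) (Fin d) ℝ :=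
  Matrix.of fun i j => if t < |A i j| then A i j else 0

/-- The private covariance estimator, on records `x` and noise matrix `N`: clip, average,
add the noise, apply hard thresholding. -/
def privCov {n d : ℕ} (γ r ε δ : ℝ) (x : Fin n → EuclideanSpace ℝ (Fin d))
    (N : Matrix (Fin d) (Fin d) ℝ) : Matrix (Fin d) (Fin d) ℝ :=
  hardThreshold (thres n d γ r ε δ) (clippedCov r x + N)

/-- The records `x 0, …, x (n-1)` are i.i.d. with law `P`. The noise matrix `N` is symmetric, its
entries on and above the diagonal are i.i.d. centred Gaussian with variance `v`, and it is
independent of the records. -/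
structure SamplingModel {Ω : Type*} [MeasurableSpace Ω] (μ : Measure Ω) {n d : ℕ}
    (P : Measure (EuclideanSpace ℝ (Fin d))) (v : ℝ)
    (x : Fin n → Ω → EuclideanSpace ℝ (Fin d))
    (N : Fin d → Fin d → Ω → ℝ) : Prop where
  record_law : ∀ i, HasLaw (x i) P μ
  record_indep : iIndepFun x μ
  noise_symm : ∀ i j ω, N i j ω = N j i ω
  noise_law : ∀ i j, i ≤ j → HasLaw (N i j) (gaussianReal 0 v.toNNReal) μ
  noise_indep : iIndepFun (fun p : {p : Fin d × Fin d // p.1 ≤ p.2} => N p.1.1 p.1.2) μ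
  record_noise_indep : IndepFun (fun ω i => x i ω)
    (fun ω (p : {p : Fin d × Fin d // p.1 ≤ p.2}) => N p.1.1 p.1.2 ω) μ

/-- The squared `ℓ_∞`-operator-norm error `‖Σ̈ - Σ‖_∞²` as a random variable. -/
def sqError {Ω : Type*} {n d : ℕ} (P : Measure (EuclideanSpace ℝ (Fin d))) (γ r ε δ : ℝ)
    (x : Fin n → Ω → EuclideanSpace ℝ (Fin d)) (N : Fin d → Fin d → Ω → ℝ) (ω : Ω) : ℝ :=
  infNorm (privCov γ r ε δ (fun i => x i ω) (Matrix.of fun i j => N i j ω) - covMatrix P) ^ 2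

/-- The quantity `log d · log(1/δ) · r⁴ / (n ε²)`. -/
def baseRate (n d : ℕ) (r ε δ : ℝ) : ℝ :=
  Real.log d * Real.log (1 / δ) * r ^ 4 / (n * ε ^ 2)

end PrivCov

end

/-! Write D = Σ̇ - Σ and t = Thres. If all |D_jk| ≤ t/2, thresholding leaves an error of at most
min(|σ_jk|, 3t/2) ≤ |σ_jk|^q (3t/2)^(1-q) in each entry, and sparsity of the rows gives ‖Σ̈ - Σ‖_∞ ≤
s (3t/2)^(1-q). Otherwise the error is at most d(t + max|D_jk|), and its square is dominated by a
small factor times ∑ exp(θ|D_jk|). `sq_infNorm_hardThreshold_sub_le` merges the two cases into one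
pointwise inequality; integrating it bounds the risk, and Markov's inequality applied to the same
sum gives the high-probability bound.

The probabilistic input is `SamplingModel.exp_entryDev_le`: E exp(θ|D_jk|) ≤ d^4 for θ of order √(n
log d). D splits into sampling error, clipping bias and noise. Products of coordinates have
exponential moments at scale d/σ², so a Bernstein argument works without assuming log d ≲ n; r ≥
2σ√(log n) makes the bias O(n^(-1/2)); the bound on r^4 log(1/δ)/ε² makes the noise variance O(1/n).
All three live at scale √(log d / n). A large γ makes exp(-θγ√(log d / n)/4) beat the powers of d,
and both t² and 1/θ² are O(B). -/

namespace PrivCov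

/-! ### Exponential moments of sub-Gaussian variables -/

/-- An upper bound on the Lebesgue integral of a nonnegative function gives integrability and
the same bound on the Bochner integral. -/
theorem integrable_and_integral_le_of_lintegral_le {α : Type*} [MeasurableSpace α] {μ : Measure α}
    {f : α → ℝ} {c : ℝ} (hf : AEStronglyMeasurable f μ) (h0 : ∀ a, 0 ≤ f a) (hc : 0 ≤ c)
    (h : ∫⁻ a, ENNReal.ofReal (f a) ∂μ ≤ ENNReal.ofReal c) :
    Integrable f μ ∧ ∫ a, f a ∂μ ≤ c := by
  refine ⟨⟨hf, ?_⟩, ?_⟩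
  · rw [hasFiniteIntegral_iff_ofReal (Filter.Eventually.of_forall h0)]
    exact h.trans_lt ENNReal.ofReal_lt_top
  · rw [integral_eq_lintegral_of_nonneg_ae (Filter.Eventually.of_forall h0) hf]
    exact ENNReal.toReal_le_of_le_ofReal hc h

/-- `E exp (g ^ 2 / 4) ≤ 2` for a standard Gaussian `g`. -/
theorem lintegral_exp_sq_div_four_gaussianReal :
    ∫⁻ g : ℝ, ENNReal.ofReal (Real.exp (g ^ 2 / 4)) ∂(gaussianReal 0 1) ≤ ENNReal.ofReal 2 := by
  rw [gaussianReal_of_var_ne_zero _ one_ne_zero,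
    lintegral_withDensity_eq_lintegral_mul _ (measurable_gaussianPDF _ _) (by fun_prop)]
  have key : ∀ g : ℝ, (gaussianPDF 0 1 * fun g => ENNReal.ofReal (Real.exp (g ^ 2 / 4))) g =
      ENNReal.ofReal ((√(2 * Real.pi))⁻¹ * Real.exp (-(1 / 4) * g ^ 2)) := by
    intro g
    simp only [Pi.mul_apply, gaussianPDF, gaussianPDFReal]
    rw [← ENNReal.ofReal_mul (by positivity), mul_assoc, ← Real.exp_add]
    congr 3
    · simp
    · simp; ring
  simp_rw [key]
  rw [← ofReal_integral_eq_lintegral_ofReal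
    ((integrable_exp_neg_mul_sq (by norm_num)).const_mul _)
    (Filter.Eventually.of_forall fun g => by positivity), integral_const_mul, integral_gaussian]
  apply ENNReal.ofReal_le_ofReal
  have h2 : √(Real.pi / (1 / 4)) ≤ 2 * √(2 * Real.pi) := by
    rw [show (2 : ℝ) * √(2 * Real.pi) = √(2 ^ 2 * (2 * Real.pi)) by
      rw [Real.sqrt_mul (show (0 : ℝ) ≤ 2 ^ 2 by norm_num), Real.sqrt_sq (by norm_num)]]
    apply Real.sqrt_le_sqrt
    have := Real.pi_pos
    linarith
  have h3 : 0 < √(2 * Real.pi) := Real.sqrt_pos.2 (by positivity)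
  rw [inv_mul_le_iff₀ h3]
  linarith

/-- The square of a `v`-sub-Gaussian variable has an exponential moment at `1 / (4 v)`. -/
theorem exp_sq_of_hasSubgaussianMGF {Ω : Type*} [MeasurableSpace Ω] {μ : Measure Ω} [SFinite μ]
    {X : Ω → ℝ} {v : NNReal} (hv : 0 < v) (h : HasSubgaussianMGF X v μ) :
    Integrable (fun ω => Real.exp (X ω ^ 2 / (4 * v))) μ ∧
      ∫ ω, Real.exp (X ω ^ 2 / (4 * v)) ∂μ ≤ 2 := by
  have hv' : (0 : ℝ) < v := by exact_mod_cast hv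
  have hX := h.aemeasurable
  refine integrable_and_integral_le_of_lintegral_le
    ((Real.measurable_exp.comp_aemeasurable
      ((hX.pow_const 2).div_const _)).aestronglyMeasurable)
    (fun _ => (Real.exp_pos _).le) (by norm_num) ?_
  -- Gaussian linearization: exp(X²/(4v)) = E_g exp(Xg/w) with w² = 2v. After swapping the
  -- integrals, the sub-Gaussian bound in X leaves exp(g²/4).
  set w : ℝ := √(2 * v) with hw
  have hw2 : w ^ 2 = 2 * v := Real.sq_sqrt (by positivity)
  have hw0 : 0 < w := Real.sqrt_pos.2 (by positivity)
  have e1 : ∀ ω, ENNReal.ofReal (Real.exp (X ω ^ 2 / (4 * v))) =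
      ∫⁻ g, ENNReal.ofReal (Real.exp (X ω / w * g)) ∂(gaussianReal 0 1) := by
    intro ω
    rw [← ofReal_integral_eq_lintegral_ofReal (integrable_exp_mul_gaussianReal _)
      (Filter.Eventually.of_forall fun g => (Real.exp_pos _).le)]
    have := mgf_gaussianReal (p := gaussianReal 0 1) (X := id) (μ := 0) (v := 1) (by simp)
      (X ω / w)
    rw [mgf] at this
    simp only [id] at this
    rw [this]
    congr 2
    simp [div_pow, hw2]
    field_simp
    ring
  simp_rw [e1]
  rw [lintegral_lintegral_swap]
  · refine le_trans (lintegral_mono fun g => ?_) lintegral_exp_sq_div_four_gaussianReal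
    have e2 : ∀ ω, Real.exp (X ω / w * g) = Real.exp (g / w * X ω) := fun ω => by
      congr 1; ring
    simp_rw [e2]
    rw [← ofReal_integral_eq_lintegral_ofReal (h.integrable_exp_mul _)
      (Filter.Eventually.of_forall fun g => (Real.exp_pos _).le)]
    apply ENNReal.ofReal_le_ofReal
    refine (h.mgf_le (g / w)).trans (le_of_eq ?_)
    congr 1
    rw [div_pow, hw2]
    field_simp
    ring
  · have h1 : AEMeasurable (fun p : Ω × ℝ => X p.1) (μ.prod (gaussianReal 0 1)) :=
      hX.comp_fst
    exact (Real.measurable_exp.comp_aemeasurable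
      ((h1.div_const w).mul measurable_snd.aemeasurable)).ennreal_ofReal

/-- A sub-Gaussian variable is centred. -/
theorem integral_eq_zero_of_hasSubgaussianMGF {Ω : Type*} [MeasurableSpace Ω] {μ : Measure Ω}
    [IsProbabilityMeasure μ] {X : Ω → ℝ} {v : NNReal} (h : HasSubgaussianMGF X v μ) :
    ∫ ω, X ω ∂μ = 0 := by
  set m := ∫ ω, X ω ∂μ with hm
  -- Since 1 + tm ≤ E exp(tX) ≤ exp(vt²/2), `f` is nonnegative and vanishes at 0; its derivative
  -- there is -m.
  let f : ℝ → ℝ := fun t => Real.exp (v * t ^ 2 / 2) - (t * m + 1)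
  have hf : ∀ t, f 0 ≤ f t := by
    intro t
    have h1 : t * m + 1 ≤ Real.exp (v * t ^ 2 / 2) := by
      refine le_trans ?_ (h.mgf_le t)
      have : t * m + 1 = ∫ ω, (t * X ω + 1) ∂μ := by
        rw [integral_add (h.integrable.const_mul t) (integrable_const _), integral_const_mul]
        simp [hm]
      rw [this]
      exact integral_mono ((h.integrable.const_mul t).add (integrable_const _))
        (h.integrable_exp_mul t) fun ω => Real.add_one_le_exp _
    simp only [f]
    simp
    linarith
  have hmin : IsLocalMin f 0 := Filter.Eventually.of_forall hf
  have hd : HasDerivAt f (Real.exp (v * (0 : ℝ) ^ 2 / 2) * (v * (2 * (0 : ℝ)) / 2) - m) 0 := by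
    have h1 : HasDerivAt (fun t : ℝ => (v : ℝ) * t ^ 2 / 2) (v * (2 * (0 : ℝ)) / 2) 0 := by
      simpa using (((hasDerivAt_pow 2 (0 : ℝ)).const_mul (v : ℝ)).div_const 2)
    have h2 : HasDerivAt (fun t : ℝ => t * m + 1) m 0 := by
      simpa using ((hasDerivAt_id (0 : ℝ)).mul_const m).add_const 1
    exact h1.exp.sub h2
  have := hmin.hasDerivAt_eq_zero hd
  simp at this
  exact this

/-- A Bernstein-type bound: a variable with `E exp (2 |Z|) ≤ M` satisfies
`E exp (t (Z - E Z)) ≤ exp (2 M t ^ 2)` for `|t| ≤ 1`. -/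
theorem exp_centered_le {Ω : Type*} [MeasurableSpace Ω] {μ : Measure Ω}
    [IsProbabilityMeasure μ] {Z : Ω → ℝ} {M t : ℝ} (hZ : AEStronglyMeasurable Z μ)
    (hi : Integrable (fun ω => Real.exp (2 * |Z ω|)) μ)
    (hM : ∫ ω, Real.exp (2 * |Z ω|) ∂μ ≤ M) (ht : |t| ≤ 1) :
    Integrable (fun ω => Real.exp (t * (Z ω - ∫ ω, Z ω ∂μ))) μ ∧
      ∫ ω, Real.exp (t * (Z ω - ∫ ω, Z ω ∂μ)) ∂μ ≤ Real.exp (2 * M * t ^ 2) := by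
  have hZi : Integrable Z μ := hi.mono hZ (Filter.Eventually.of_forall fun ω => by
    rw [Real.norm_eq_abs, Real.norm_eq_abs, Real.abs_exp]
    have := Real.add_one_le_exp (2 * |Z ω|)
    have := abs_nonneg (Z ω)
    linarith)
  have hZm := hZ.aemeasurable
  have hei : Integrable (fun ω => Real.exp (t * Z ω)) μ := by
    refine hi.mono
      ((Real.measurable_exp.comp_aemeasurable (hZm.const_mul t)).aestronglyMeasurable)
      (Filter.Eventually.of_forall fun ω => ?_)
    rw [Real.norm_eq_abs, Real.norm_eq_abs, Real.abs_exp, Real.abs_exp]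
    apply Real.exp_le_exp.2
    have h1 : t * Z ω ≤ |t| * |Z ω| := by rw [← abs_mul]; exact le_abs_self _
    have := abs_nonneg (Z ω)
    nlinarith
  -- Second-order Taylor remainder, with z² ≤ 2 exp|z| absorbing the square. After integration, 1 +
  -- u ≤ exp u lets the centring cancel the linear term.
  have pt : ∀ z : ℝ, Real.exp (t * z) ≤ 1 + t * z + 2 * t ^ 2 * Real.exp (2 * |z|) := by
    intro z
    have h1 := Complex.norm_exp_sub_sum_le_norm_mul_exp ((t * z : ℝ) : ℂ) 2
    simp only [Finset.sum_range_succ, Finset.sum_range_zero, pow_zero, pow_one,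
      Nat.factorial] at h1
    have h2 : Complex.exp ((t * z : ℝ) : ℂ) -
        (0 + 1 / ((1 : ℕ) : ℂ) + ((t * z : ℝ) : ℂ) / (((0 + 1) * 1 : ℕ) : ℂ)) =
        ((Real.exp (t * z) - (1 + t * z) : ℝ) : ℂ) := by push_cast; ring
    rw [h2, Complex.norm_real, Complex.norm_real, Real.norm_eq_abs, Real.norm_eq_abs] at h1
    have h3 := le_trans (le_abs_self _) h1
    have h4 : |t * z| ≤ |z| := by
      rw [abs_mul]; exact mul_le_of_le_one_left (abs_nonneg _) ht
    have h5 : Real.exp |t * z| ≤ Real.exp |z| := Real.exp_le_exp.2 h4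
    have h6 : z ^ 2 ≤ 2 * Real.exp |z| := by
      have := Real.quadratic_le_exp_of_nonneg (abs_nonneg z)
      rw [sq_abs] at this
      have := abs_nonneg z
      nlinarith
    have h7 : |t * z| ^ 2 * Real.exp |t * z| ≤ 2 * t ^ 2 * Real.exp (2 * |z|) := by
      rw [sq_abs, two_mul |z|, Real.exp_add]
      have hp := Real.exp_pos |z|
      calc (t * z) ^ 2 * Real.exp |t * z| ≤ (t * z) ^ 2 * Real.exp |z| := by gcongr
        _ = t ^ 2 * z ^ 2 * Real.exp |z| := by ring
        _ ≤ t ^ 2 * (2 * Real.exp |z|) * Real.exp |z| := by gcongr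
        _ = _ := by ring
    linarith
  have e : ∀ ω, Real.exp (t * (Z ω - ∫ ω, Z ω ∂μ)) =
      Real.exp (-(t * ∫ ω, Z ω ∂μ)) * Real.exp (t * Z ω) := fun ω => by
    rw [← Real.exp_add]; congr 1; ring
  simp_rw [e]
  refine ⟨hei.const_mul _, ?_⟩
  rw [integral_const_mul]
  have h1 : ∫ ω, Real.exp (t * Z ω) ∂μ ≤ 1 + t * ∫ ω, Z ω ∂μ + 2 * t ^ 2 * M := by
    have hint : Integrable (fun ω => 1 + t * Z ω) μ :=
      (integrable_const _).add (hZi.const_mul t)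
    calc ∫ ω, Real.exp (t * Z ω) ∂μ
        ≤ ∫ ω, (1 + t * Z ω + 2 * t ^ 2 * Real.exp (2 * |Z ω|)) ∂μ :=
          integral_mono hei (hint.add (hi.const_mul _)) fun ω => pt _
      _ = 1 + t * ∫ ω, Z ω ∂μ + 2 * t ^ 2 * ∫ ω, Real.exp (2 * |Z ω|) ∂μ := by
          rw [integral_add hint (hi.const_mul _),
            integral_add (integrable_const _) (hZi.const_mul t), integral_const_mul,
            integral_const_mul]
          simp
      _ ≤ _ := by gcongr
  have h2 := Real.add_one_le_exp (t * ∫ ω, Z ω ∂μ + 2 * M * t ^ 2)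
  calc Real.exp (-(t * ∫ ω, Z ω ∂μ)) * ∫ ω, Real.exp (t * Z ω) ∂μ
      ≤ Real.exp (-(t * ∫ ω, Z ω ∂μ)) * Real.exp (t * ∫ ω, Z ω ∂μ + 2 * M * t ^ 2) := by
        gcongr; linarith
    _ = _ := by rw [← Real.exp_add]; congr 1; ring

/-! ### Coordinates, norm and clipping of a sub-Gaussian record -/

theorem IsSubGaussianLaw.coord {d : ℕ} {P : Measure (EuclideanSpace ℝ (Fin d))} {v : NNReal}
    (h : IsSubGaussianLaw P v) (j : Fin d) :
    HasSubgaussianMGF (fun x : EuclideanSpace ℝ (Fin d) => x j) v P := by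
  have := h (EuclideanSpace.single j 1) (by simp)
  simpa [EuclideanSpace.inner_single_left] using this

theorem IsSubGaussianLaw.covMatrix_apply {d : ℕ} {P : Measure (EuclideanSpace ℝ (Fin d))}
    [IsProbabilityMeasure P] {v : NNReal} (h : IsSubGaussianLaw P v) (j k : Fin d) :
    covMatrix P j k = ∫ x, x j * x k ∂P := by
  simp [covMatrix, covariance, integral_eq_zero_of_hasSubgaussianMGF (h.coord _)]

theorem IsSubGaussianLaw.exp_coord_sq {d : ℕ} (hd : 0 < d)
    {P : Measure (EuclideanSpace ℝ (Fin d))} [IsProbabilityMeasure P] {σ : ℝ} (hσ : 0 < σ)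
    (h : IsSubGaussianLaw P (σ ^ 2 / d).toNNReal) (j : Fin d) :
    Integrable (fun x : EuclideanSpace ℝ (Fin d) => Real.exp (d / (4 * σ ^ 2) * x j ^ 2)) P ∧
      ∫ x, Real.exp (d / (4 * σ ^ 2) * x j ^ 2) ∂P ≤ 2 := by
  have hd' : (0 : ℝ) < d := by exact_mod_cast hd
  have hv : 0 < σ ^ 2 / d := by positivity
  have := exp_sq_of_hasSubgaussianMGF (Real.toNNReal_pos.2 hv) (h.coord j)
  rw [Real.coe_toNNReal _ hv.le] at this
  convert this using 5 <;> field_simp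

theorem exp_mul_abs_mul_le (a x y : ℝ) (ha : 0 ≤ a) :
    Real.exp (a * |x * y|) ≤ (Real.exp (a * x ^ 2) + Real.exp (a * y ^ 2)) / 2 := by
  have h1 : a * |x * y| ≤ a * x ^ 2 / 2 + a * y ^ 2 / 2 := by
    rw [abs_mul, ← sq_abs x, ← sq_abs y]
    nlinarith [mul_nonneg ha (sq_nonneg (|x| - |y|))]
  have h2 : ∀ u : ℝ, Real.exp u = Real.exp (u / 2) ^ 2 := fun u => by
    rw [← Real.exp_nat_mul]; congr 1; push_cast; ring
  calc Real.exp (a * |x * y|) ≤ Real.exp (a * x ^ 2 / 2 + a * y ^ 2 / 2) := Real.exp_le_exp.2 h1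
    _ = Real.exp (a * x ^ 2 / 2) * Real.exp (a * y ^ 2 / 2) := Real.exp_add _ _
    _ ≤ _ := by
      rw [h2 (a * x ^ 2), h2 (a * y ^ 2)]
      nlinarith [sq_nonneg (Real.exp (a * x ^ 2 / 2) - Real.exp (a * y ^ 2 / 2))]

theorem IsSubGaussianLaw.exp_mul_coord {d : ℕ} (hd : 0 < d)
    {P : Measure (EuclideanSpace ℝ (Fin d))} [IsProbabilityMeasure P] {σ : ℝ} (hσ : 0 < σ)
    (h : IsSubGaussianLaw P (σ ^ 2 / d).toNNReal) (j k : Fin d) :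
    Integrable (fun x : EuclideanSpace ℝ (Fin d) =>
        Real.exp (d / (4 * σ ^ 2) * |x j * x k|)) P ∧
      ∫ x, Real.exp (d / (4 * σ ^ 2) * |x j * x k|) ∂P ≤ 2 := by
  have hj := h.exp_coord_sq hd hσ j
  have hk := h.exp_coord_sq hd hσ k
  have ha : (0 : ℝ) ≤ d / (4 * σ ^ 2) := by positivity
  have hi := (hj.1.add hk.1).div_const 2
  have hI : Integrable (fun x : EuclideanSpace ℝ (Fin d) =>
        Real.exp (d / (4 * σ ^ 2) * |x j * x k|)) P := by
    refine hi.mono (by fun_prop) (Filter.Eventually.of_forall fun x => ?_)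
    rw [Real.norm_eq_abs, Real.norm_eq_abs, Real.abs_exp]
    exact (exp_mul_abs_mul_le _ _ _ ha).trans (le_abs_self _)
  refine ⟨hI, (integral_mono hI hi fun x => exp_mul_abs_mul_le _ _ _ ha).trans ?_⟩
  simp only [Pi.add_apply]
  rw [integral_div, integral_add hj.1 hk.1]
  linarith [hj.2, hk.2]

/-- Jensen's inequality: ‖x‖²/(4σ²) is the average over j of d x_j²/(4σ²), so the bound is free of
the dimension. -/
theorem IsSubGaussianLaw.exp_norm_sq {d : ℕ} (hd : 0 < d)
    {P : Measure (EuclideanSpace ℝ (Fin d))} [IsProbabilityMeasure P] {σ : ℝ} (hσ : 0 < σ)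
    (h : IsSubGaussianLaw P (σ ^ 2 / d).toNNReal) :
    Integrable (fun x : EuclideanSpace ℝ (Fin d) => Real.exp (‖x‖ ^ 2 / (4 * σ ^ 2))) P ∧
      ∫ x, Real.exp (‖x‖ ^ 2 / (4 * σ ^ 2)) ∂P ≤ 2 := by
  have hd' : (0 : ℝ) < d := by exact_mod_cast hd
  have pt : ∀ x : EuclideanSpace ℝ (Fin d), Real.exp (‖x‖ ^ 2 / (4 * σ ^ 2)) ≤
      ∑ j, (1 / (d : ℝ)) * Real.exp (d / (4 * σ ^ 2) * x j ^ 2) := by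
    intro x
    have := convexOn_exp.map_sum_le (t := Finset.univ) (w := fun _ : Fin d => 1 / (d : ℝ))
      (p := fun j => d / (4 * σ ^ 2) * x j ^ 2) (fun _ _ => by positivity)
      (by simp [hd'.ne']) (fun _ _ => Set.mem_univ _)
    simp only [smul_eq_mul] at this
    refine le_trans (le_of_eq ?_) this
    rw [EuclideanSpace.real_norm_sq_eq, Finset.sum_div]
    congr 1
    refine Finset.sum_congr rfl fun j _ => ?_
    field_simp
  have hi : Integrable (fun x : EuclideanSpace ℝ (Fin d) =>
      ∑ j, (1 / (d : ℝ)) * Real.exp (d / (4 * σ ^ 2) * x j ^ 2)) P :=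
    integrable_finsetSum _ fun j _ => (h.exp_coord_sq hd hσ j).1.const_mul _
  have hI : Integrable (fun x : EuclideanSpace ℝ (Fin d) =>
      Real.exp (‖x‖ ^ 2 / (4 * σ ^ 2))) P := by
    refine hi.mono (by fun_prop) (Filter.Eventually.of_forall fun x => ?_)
    rw [Real.norm_eq_abs, Real.norm_eq_abs, Real.abs_exp]
    exact (pt x).trans (le_abs_self _)
  refine ⟨hI, (integral_mono hI hi pt).trans ?_⟩
  rw [integral_finsetSum _ fun j _ => (h.exp_coord_sq hd hσ j).1.const_mul _]
  calc ∑ j, ∫ x : EuclideanSpace ℝ (Fin d), 1 / (d : ℝ) * Real.exp (d / (4 * σ ^ 2) * x j ^ 2) ∂P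
      ≤ ∑ _j : Fin d, 1 / (d : ℝ) * 2 := by
        refine Finset.sum_le_sum fun j _ => ?_
        rw [integral_const_mul]
        gcongr
        exact (h.exp_coord_sq hd hσ j).2
    _ = 2 := by simp; field_simp

theorem clip_apply {d : ℕ} (r : ℝ) (x : EuclideanSpace ℝ (Fin d)) (j : Fin d) :
    clip r x j = min 1 (r / ‖x‖) * x j := by simp [clip]

theorem measurable_clip_apply {d : ℕ} (r : ℝ) (j : Fin d) :
    Measurable fun x : EuclideanSpace ℝ (Fin d) => clip r x j := by
  simp_rw [clip_apply]
  fun_prop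

theorem abs_clip_mul_le {d : ℕ} {r : ℝ} (hr : 0 ≤ r) (x : EuclideanSpace ℝ (Fin d))
    (j k : Fin d) : |clip r x j * clip r x k| ≤ |x j * x k| := by
  have h0 : 0 ≤ min 1 (r / ‖x‖) := le_min zero_le_one (by positivity)
  have h1 : min 1 (r / ‖x‖) ≤ 1 := min_le_left _ _
  rw [clip_apply, clip_apply,
    show ∀ m a b : ℝ, m * a * (m * b) = m * m * (a * b) by intros; ring, abs_mul,
    abs_of_nonneg (mul_nonneg h0 h0)]
  exact mul_le_of_le_one_left (abs_nonneg _) (mul_le_one₀ h1 h0 h1)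

theorem clip_of_norm_le {d : ℕ} {r : ℝ} {x : EuclideanSpace ℝ (Fin d)} (h : ‖x‖ ≤ r) :
    clip r x = x := by
  -- At x = 0 the factor is min 1 (r / 0) = min 1 0, which is harmless as it multiplies 0.
  rcases eq_or_ne x 0 with rfl | hx
  · simp [clip]
  · have : 0 < ‖x‖ := norm_pos_iff.2 hx
    rw [clip, min_eq_left ((one_le_div this).2 h), one_smul]

/-- Only ‖x‖ > r contributes, and there the error is at most ‖x‖² = 8σ²u with u = ‖x‖²/(8σ²). As u
exceeds w = r²/(8σ²), u ≤ exp u ≤ exp(-w) exp(2u). -/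
theorem abs_clip_mul_sub_le {d : ℕ} {r σ : ℝ} (hr : 0 ≤ r) (hσ : 0 < σ)
    (x : EuclideanSpace ℝ (Fin d)) (j k : Fin d) :
    |clip r x j * clip r x k - x j * x k| ≤
      8 * σ ^ 2 * Real.exp (-(r ^ 2 / (8 * σ ^ 2))) * Real.exp (‖x‖ ^ 2 / (4 * σ ^ 2)) := by
  rcases le_or_gt ‖x‖ r with h | h
  · rw [clip_of_norm_le h]
    simp
    positivity
  · have h0 : 0 ≤ min 1 (r / ‖x‖) := le_min zero_le_one (by positivity)
    have h1 : min 1 (r / ‖x‖) ≤ 1 := min_le_left _ _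
    have e1 : |clip r x j * clip r x k - x j * x k| ≤ |x j * x k| := by
      rw [clip_apply, clip_apply,
        show ∀ m a b : ℝ, m * a * (m * b) - a * b = -((1 - m * m) * (a * b)) by intros; ring,
        abs_neg, abs_mul]
      refine mul_le_of_le_one_left (abs_nonneg _) ?_
      rw [abs_le]
      have := mul_le_one₀ h1 h0 h1
      have := mul_nonneg h0 h0
      constructor <;> linarith
    have e2 : |x j * x k| ≤ ‖x‖ ^ 2 := by
      rw [abs_mul, sq]
      gcongr
      · exact PiLp.norm_apply_le x j
      · exact PiLp.norm_apply_le x k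
    set u := ‖x‖ ^ 2 / (8 * σ ^ 2) with hu
    set w := r ^ 2 / (8 * σ ^ 2) with hw
    have e3 : ‖x‖ ^ 2 = 8 * σ ^ 2 * u := by rw [hu]; field_simp
    have e4 : ‖x‖ ^ 2 / (4 * σ ^ 2) = u + u := by rw [hu]; field_simp; ring
    have e5 : w ≤ u := by rw [hu, hw]; gcongr
    have e6 : u ≤ Real.exp (-w) * Real.exp (u + u) := by
      rw [← Real.exp_add]
      calc u ≤ Real.exp u := by linarith [Real.add_one_le_exp u]
        _ ≤ _ := Real.exp_le_exp.2 (by linarith)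
    rw [e4, mul_assoc]
    calc _ ≤ ‖x‖ ^ 2 := e1.trans e2
      _ = 8 * σ ^ 2 * u := e3
      _ ≤ _ := by gcongr

theorem integrable_of_exp_mul_abs {Ω : Type*} [MeasurableSpace Ω] {μ : Measure Ω} {Y : Ω → ℝ}
    {a : ℝ} (ha : 0 < a) (hY : AEStronglyMeasurable Y μ)
    (h : Integrable (fun ω => Real.exp (a * |Y ω|)) μ) : Integrable Y μ := by
  refine (h.div_const a).mono hY (Filter.Eventually.of_forall fun ω => ?_)
  rw [Real.norm_eq_abs, Real.norm_of_nonneg (by positivity), le_div_iff₀ ha]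
  linarith [Real.add_one_le_exp (a * |Y ω|)]

theorem IsSubGaussianLaw.exp_clip_mul {d : ℕ} (hd : 0 < d)
    {P : Measure (EuclideanSpace ℝ (Fin d))} [IsProbabilityMeasure P] {σ r : ℝ} (hσ : 0 < σ)
    (hr : 0 ≤ r) (h : IsSubGaussianLaw P (σ ^ 2 / d).toNNReal) (j k : Fin d) :
    Integrable (fun x : EuclideanSpace ℝ (Fin d) =>
        Real.exp (d / (4 * σ ^ 2) * |clip r x j * clip r x k|)) P ∧
      ∫ x, Real.exp (d / (4 * σ ^ 2) * |clip r x j * clip r x k|) ∂P ≤ 2 := by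
  have hjk := h.exp_mul_coord hd hσ j k
  have pt : ∀ x : EuclideanSpace ℝ (Fin d),
      Real.exp (d / (4 * σ ^ 2) * |clip r x j * clip r x k|) ≤
      Real.exp (d / (4 * σ ^ 2) * |x j * x k|) := fun x =>
    Real.exp_le_exp.2 (mul_le_mul_of_nonneg_left (abs_clip_mul_le hr x j k) (by positivity))
  have hI : Integrable (fun x : EuclideanSpace ℝ (Fin d) =>
        Real.exp (d / (4 * σ ^ 2) * |clip r x j * clip r x k|)) P := by
    have hj := measurable_clip_apply r j
    have hk := measurable_clip_apply r k
    refine hjk.1.mono (by fun_prop) (Filter.Eventually.of_forall fun x => ?_)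
    rw [Real.norm_eq_abs, Real.norm_eq_abs, Real.abs_exp, Real.abs_exp]
    exact pt x
  exact ⟨hI, (integral_mono hI hjk.1 pt).trans hjk.2⟩

/-- The bias due to clipping. -/
theorem IsSubGaussianLaw.abs_integral_clip_sub_covMatrix_le {d : ℕ} (hd : 0 < d)
    {P : Measure (EuclideanSpace ℝ (Fin d))} [IsProbabilityMeasure P] {σ r : ℝ} (hσ : 0 < σ)
    (hr : 0 ≤ r) (h : IsSubGaussianLaw P (σ ^ 2 / d).toNNReal) (j k : Fin d) :
    |∫ x, clip r x j * clip r x k ∂P - covMatrix P j k| ≤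
      16 * σ ^ 2 * Real.exp (-(r ^ 2 / (8 * σ ^ 2))) := by
  have hd' : (0 : ℝ) < d := by exact_mod_cast hd
  have hj := measurable_clip_apply r j
  have hk := measurable_clip_apply r k
  have i1 : Integrable (fun x : EuclideanSpace ℝ (Fin d) => clip r x j * clip r x k) P :=
    integrable_of_exp_mul_abs (a := d / (4 * σ ^ 2)) (by positivity)
      (hj.mul hk).aestronglyMeasurable (h.exp_clip_mul hd hσ hr j k).1
  have i2 : Integrable (fun x : EuclideanSpace ℝ (Fin d) => x j * x k) P :=
    integrable_of_exp_mul_abs (a := d / (4 * σ ^ 2)) (by positivity)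
      (by fun_prop) (h.exp_mul_coord hd hσ j k).1
  have hn := h.exp_norm_sq hd hσ
  rw [h.covMatrix_apply, ← integral_sub i1 i2]
  refine (abs_integral_le_integral_abs).trans ?_
  refine (integral_mono (i1.sub i2).abs (hn.1.const_mul _)
    fun x => abs_clip_mul_sub_le hr hσ x j k).trans ?_
  rw [integral_const_mul]
  calc _ ≤ 8 * σ ^ 2 * Real.exp (-(r ^ 2 / (8 * σ ^ 2))) * 2 := by gcongr; exact hn.2
    _ = _ := by ring

/-! ### Exponential moments of the entrywise deviations -/

theorem HasLaw.integrable_comp_real {Ω 𝓧 : Type*} [MeasurableSpace Ω] [MeasurableSpace 𝓧]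
    {P : Measure Ω} {ν : Measure 𝓧} {X : Ω → 𝓧} (hX : HasLaw X ν P) {f : 𝓧 → ℝ}
    (hf : Integrable f ν) : Integrable (fun ω => f (X ω)) P :=
  Integrable.comp_aemeasurable (by rwa [hX.map_eq]) hX.aemeasurable

theorem integrable_exp_mul_abs {Ω : Type*} [MeasurableSpace Ω] {μ : Measure Ω} {X : Ω → ℝ}
    {t b : ℝ} (hX : AEStronglyMeasurable X μ)
    (h1 : Integrable (fun ω => Real.exp (t * X ω)) μ)
    (h2 : Integrable (fun ω => Real.exp (-t * X ω)) μ)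
    (b1 : ∫ ω, Real.exp (t * X ω) ∂μ ≤ b) (b2 : ∫ ω, Real.exp (-t * X ω) ∂μ ≤ b) :
    Integrable (fun ω => Real.exp (t * |X ω|)) μ ∧ ∫ ω, Real.exp (t * |X ω|) ∂μ ≤ 2 * b := by
  have pt : ∀ ω, Real.exp (t * |X ω|) ≤ Real.exp (t * X ω) + Real.exp (-t * X ω) := fun ω => by
    have p1 := Real.exp_pos (t * X ω)
    have p2 := Real.exp_pos (-t * X ω)
    rcases abs_choice (X ω) with h | h <;> rw [h]
    · linarith
    · rw [mul_neg, ← neg_mul]; linarith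
  have hI : Integrable (fun ω => Real.exp (t * |X ω|)) μ := by
    refine (h1.add h2).mono ((Real.measurable_exp.comp_aemeasurable
      ((measurable_norm.comp_aemeasurable hX.aemeasurable).const_mul t)).aestronglyMeasurable)
      (Filter.Eventually.of_forall fun ω => ?_)
    rw [Real.norm_eq_abs, Real.norm_eq_abs, Real.abs_exp]
    exact (pt ω).trans (le_abs_self _)
  refine ⟨hI, (integral_mono hI (h1.add h2) pt).trans ?_⟩
  simp only [Pi.add_apply]
  rw [integral_add h1 h2]
  linarith

section Model

variable {Ω : Type*} [MeasurableSpace Ω] {μ : Measure Ω} {n d : ℕ}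
  {P : Measure (EuclideanSpace ℝ (Fin d))} {v : ℝ} {x : Fin n → Ω → EuclideanSpace ℝ (Fin d)}
  {N : Fin d → Fin d → Ω → ℝ}

/-- Exponential moments of centred empirical sums of i.i.d. records. -/
theorem SamplingModel.exp_sum_le [IsProbabilityMeasure μ] [IsProbabilityMeasure P]
    (hM : SamplingModel μ P v x N) {φ : EuclideanSpace ℝ (Fin d) → ℝ} (hφ : Measurable φ)
    {a M t : ℝ} (ha : 0 < a)
    (hi : Integrable (fun y => Real.exp (2 * a * |φ y|)) P)
    (hb : ∫ y, Real.exp (2 * a * |φ y|) ∂P ≤ M) (ht : |t| ≤ a) :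
    Integrable (fun ω => Real.exp (t * ∑ i, (φ (x i ω) - ∫ y, φ y ∂P))) μ ∧
      ∫ ω, Real.exp (t * ∑ i, (φ (x i ω) - ∫ y, φ y ∂P)) ∂μ ≤
        Real.exp (n * (2 * M * (t / a) ^ 2)) := by
  have habs : ∀ y, 2 * |a * φ y| = 2 * a * |φ y| := fun y => by
    rw [abs_mul, abs_of_pos ha]; ring
  have hc := exp_centered_le (μ := P) (Z := fun y => a * φ y) (M := M) (t := t / a)
    (hφ.const_mul a).aestronglyMeasurable (by simpa only [habs] using hi)
    (by simpa only [habs] using hb) (by rw [abs_div, abs_of_pos ha]; exact (div_le_one ha).2 ht)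
  set m := ∫ y, φ y ∂P with hm
  have e : ∀ y, t / a * (a * φ y - ∫ y, a * φ y ∂P) = t * (φ y - m) := fun y => by
    rw [integral_const_mul, ← hm]; field_simp
  simp only [e] at hc
  let X : Fin n → Ω → ℝ := fun i => (fun y => φ y - m) ∘ x i
  have hXm : ∀ i, AEMeasurable (X i) μ := fun i =>
    (hφ.sub_const m).comp_aemeasurable (hM.record_law i).aemeasurable
  have hind : iIndepFun X μ := hM.record_indep.comp (fun _ y => φ y - m) fun _ => hφ.sub_const m
  have hmgf : ∀ i, mgf (X i) μ t = ∫ y, Real.exp (t * (φ y - m)) ∂P := fun i =>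
    (hM.record_law i).integral_comp (f := fun y => Real.exp (t * (φ y - m)))
      hc.1.aestronglyMeasurable
  have hXi : ∀ i, Integrable (fun ω => Real.exp (t * X i ω)) μ := fun i =>
    HasLaw.integrable_comp_real (hM.record_law i) hc.1
  have hs := hind.mgf_sum₀ hXm Finset.univ (t := t)
  -- A non-integrable exponential would have `mgf` equal to the default value 0, so positivity of
  -- the product yields integrability.
  have hpos : 0 < mgf (∑ i, X i) μ t := by
    rw [hs]
    exact Finset.prod_pos fun i _ => mgf_pos (hXi i)
  have hI := mgf_pos_iff.1 hpos
  have hb2 : mgf (∑ i, X i) μ t ≤ Real.exp (n * (2 * M * (t / a) ^ 2)) := by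
    rw [hs, Finset.prod_congr rfl fun i _ => hmgf i, Finset.prod_const, Real.exp_nat_mul]
    simp only [Finset.card_univ, Fintype.card_fin]
    exact pow_le_pow_left₀ (integral_nonneg fun _ => (Real.exp_pos _).le) hc.2 n
  rw [mgf] at hb2
  simp only [Finset.sum_apply, X, Function.comp] at hI hb2
  exact ⟨hI, hb2⟩

/-- Exponential moments of the entries of the noise. -/
theorem SamplingModel.exp_noise_le [IsProbabilityMeasure μ]
    (hM : SamplingModel μ P v x N) (j k : Fin d) (t : ℝ) :
    Integrable (fun ω => Real.exp (t * N j k ω)) μ ∧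
      ∫ ω, Real.exp (t * N j k ω) ∂μ = Real.exp (v.toNNReal * t ^ 2 / 2) := by
  wlog hjk : j ≤ k generalizing j k
  · have e : N j k = N k j := funext fun ω => hM.noise_symm j k ω
    rw [e]
    exact this k j (le_of_not_ge hjk)
  have hl := hM.noise_law j k hjk
  refine ⟨HasLaw.integrable_comp_real hl (integrable_exp_mul_gaussianReal t), ?_⟩
  have := mgf_gaussianReal hl.map_eq t
  rw [mgf] at this
  rw [this]; simp

theorem SamplingModel.aemeasurable_noise (hM : SamplingModel μ P v x N) (j k : Fin d) :
    AEMeasurable (N j k) μ := by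
  rcases le_total j k with h | h
  · exact (hM.noise_law j k h).aemeasurable
  · rw [show N j k = N k j from funext fun ω => hM.noise_symm j k ω]
    exact (hM.noise_law k j h).aemeasurable

theorem SamplingModel.aemeasurable_clippedCov (hM : SamplingModel μ P v x N) (r : ℝ)
    (j k : Fin d) : AEMeasurable (fun ω => clippedCov r (fun i => x i ω) j k) μ := by
  simp only [clippedCov, Matrix.of_apply]
  refine AEMeasurable.const_mul (Finset.aemeasurable_fun_sum _ fun i _ => ?_) _
  exact ((measurable_clip_apply r j).comp_aemeasurable (hM.record_law i).aemeasurable).mul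
    ((measurable_clip_apply r k).comp_aemeasurable (hM.record_law i).aemeasurable)

/-- The deviation of an entry of the noisy matrix `Σ̇` from that of the covariance matrix. -/
noncomputable def entryDev (P : Measure (EuclideanSpace ℝ (Fin d))) (r : ℝ)
    (x : Fin n → Ω → EuclideanSpace ℝ (Fin d)) (N : Fin d → Fin d → Ω → ℝ) (j k : Fin d)
    (ω : Ω) : ℝ :=
  clippedCov r (fun i => x i ω) j k + N j k ω - covMatrix P j k

theorem SamplingModel.aemeasurable_entryDev (hM : SamplingModel μ P v x N) (r : ℝ)
    (j k : Fin d) : AEMeasurable (entryDev P r x N j k) μ :=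
  ((hM.aemeasurable_clippedCov r j k).add (hM.aemeasurable_noise j k)).sub_const _

theorem half_lt_log_natCast (hd : 2 ≤ d) : 1 / 2 < Real.log d := by
  have h : Real.log 2 ≤ Real.log d := Real.log_le_log (by norm_num) (by exact_mod_cast hd)
  linarith [Real.log_two_gt_d9]

/-- The Bernstein bound at t = κρ, ρ = √(log d / n). Its range |t| ≤ a with a = d/(8σ²) is met
because ρ ≤ d, and its exponent is at most 4 log d / d² ≤ log d. Both signs of t together give 2d.
-/
theorem SamplingModel.exp_clippedCov_le [IsProbabilityMeasure μ] [IsProbabilityMeasure P]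
    (hM : SamplingModel μ P v x N) (hn : 0 < n) (hd : 2 ≤ d) {σ r κ : ℝ} (hσ : 0 < σ)
    (hP : IsSubGaussianLaw P (σ ^ 2 / d).toNNReal) (hr : 0 ≤ r) (hκ : 0 < κ)
    (hκσ : κ * (8 * σ ^ 2) ≤ 1) (j k : Fin d) :
    Integrable (fun ω => Real.exp (κ * (n * √(Real.log d / n)) *
        |clippedCov r (fun i => x i ω) j k - ∫ y, clip r y j * clip r y k ∂P|)) μ ∧
      ∫ ω, Real.exp (κ * (n * √(Real.log d / n)) *
        |clippedCov r (fun i => x i ω) j k - ∫ y, clip r y j * clip r y k ∂P|) ∂μ ≤ 2 * d := by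
  have hn' : (0 : ℝ) < n := by exact_mod_cast hn
  have hn1 : (1 : ℝ) ≤ n := by exact_mod_cast hn
  have hd' : (2 : ℝ) ≤ d := by exact_mod_cast hd
  have hL := half_lt_log_natCast hd
  set ρ := √(Real.log d / n) with hρ
  have hρ2 : n * ρ ^ 2 = Real.log d := by
    rw [hρ, Real.sq_sqrt (by positivity)]; field_simp
  have hρ0 : 0 ≤ ρ := Real.sqrt_nonneg _
  have hLd : Real.log d ≤ d := (Real.log_le_self (by linarith))
  have hρd : ρ ≤ d := by
    rw [hρ]
    apply Real.sqrt_le_iff.2 ⟨by linarith, ?_⟩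
    rw [div_le_iff₀ hn']
    nlinarith
  set a : ℝ := d / (8 * σ ^ 2) with ha
  have ha0 : 0 < a := by positivity
  have hκa : κ * d ≤ a := by
    rw [ha, le_div_iff₀ (by positivity)]
    nlinarith
  have hκρ : κ * ρ ≤ a := (mul_le_mul_of_nonneg_left hρd hκ.le).trans hκa
  have hcl := hP.exp_clip_mul (by omega) hσ hr j k
  have h2a : (d : ℝ) / (4 * σ ^ 2) = 2 * a := by rw [ha]; field_simp; norm_num
  rw [h2a] at hcl
  have hexp : (n : ℝ) * (2 * 2 * (κ * ρ / a) ^ 2) ≤ Real.log d := by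
    have h1 : κ * ρ / a ≤ ρ / d := by
      rw [div_le_div_iff₀ ha0 (by linarith)]
      nlinarith
    have h2 : (κ * ρ / a) ^ 2 ≤ (ρ / d) ^ 2 := pow_le_pow_left₀ (by positivity) h1 2
    have h3 : (n : ℝ) * (2 * 2 * (ρ / d) ^ 2) = 4 * (Real.log d / d ^ 2) := by
      rw [← hρ2]; field_simp; ring
    have h4 : Real.log d / d ^ 2 ≤ Real.log d / 4 := by
      gcongr; nlinarith
    calc (n : ℝ) * (2 * 2 * (κ * ρ / a) ^ 2) ≤ n * (2 * 2 * (ρ / d) ^ 2) := by gcongr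
      _ ≤ Real.log d := by rw [h3]; linarith
  have hexp' := Real.exp_le_exp.2 hexp
  rw [Real.exp_log (by linarith)] at hexp'
  have hm := (measurable_clip_apply r j).mul (measurable_clip_apply r k)
  have key : ∀ s : ℝ, |s| = 1 → Integrable (fun ω => Real.exp (s * (κ * (n * ρ)) *
        (clippedCov r (fun i => x i ω) j k - ∫ y, clip r y j * clip r y k ∂P))) μ ∧
      ∫ ω, Real.exp (s * (κ * (n * ρ)) *
        (clippedCov r (fun i => x i ω) j k - ∫ y, clip r y j * clip r y k ∂P)) ∂μ ≤ d := by
    intro s hs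
    have hs2 : s ^ 2 = 1 := by rw [← sq_abs, hs]; norm_num
    have hc := hM.exp_sum_le (t := s * (κ * ρ)) hm ha0 hcl.1 hcl.2
      (by rw [abs_mul, hs, one_mul, abs_of_nonneg (by positivity)]; exact hκρ)
    have e : ∀ ω, s * (κ * ρ) * ∑ i, ((clip r (x i ω) j * clip r (x i ω) k) -
        ∫ y, clip r y j * clip r y k ∂P) = s * (κ * (n * ρ)) *
        (clippedCov r (fun i => x i ω) j k - ∫ y, clip r y j * clip r y k ∂P) := fun ω => by
      simp only [clippedCov, Matrix.of_apply, Finset.sum_sub_distrib, Finset.sum_const,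
        Finset.card_univ, Fintype.card_fin, nsmul_eq_mul]
      field_simp
    simp only [Pi.mul_apply, e] at hc
    refine ⟨hc.1, hc.2.trans (le_trans (le_of_eq ?_) hexp')⟩
    rw [mul_div_assoc, mul_pow, hs2, one_mul]
  have k1 := key 1 (by simp)
  have k2 := key (-1) (by simp)
  simp only [one_mul, neg_one_mul] at k1 k2
  exact integrable_exp_mul_abs
    ((hM.aemeasurable_clippedCov r j k).sub_const _).aestronglyMeasurable k1.1 k2.1 k1.2 k2.2

/-- The key exponential moment bound for the entries of `Σ̇ - Σ`. -/
theorem SamplingModel.exp_entryDev_le [IsProbabilityMeasure μ] [IsProbabilityMeasure P]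
    (hM : SamplingModel μ P v x N) (hn : 2 ≤ n) (hd : 2 ≤ d) {σ r κ : ℝ} (hσ : 0 < σ)
    (hP : IsSubGaussianLaw P (σ ^ 2 / d).toNNReal) (hr : 2 * σ * √(Real.log n) ≤ r)
    (hκ : 0 < κ) (hκσ : κ * (8 * σ ^ 2) ≤ 1) (hκv : κ ^ 2 * n * v ≤ 2) (j k : Fin d) :
    Integrable (fun ω => Real.exp (κ / 2 * (n * √(Real.log d / n)) *
        |entryDev P r x N j k ω|)) μ ∧
      ∫ ω, Real.exp (κ / 2 * (n * √(Real.log d / n)) * |entryDev P r x N j k ω|) ∂μ ≤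
        (d : ℝ) ^ 4 := by
  have hn' : (2 : ℝ) ≤ n := by exact_mod_cast hn
  have hd' : (2 : ℝ) ≤ d := by exact_mod_cast hd
  have hL := half_lt_log_natCast hd
  have hLn := half_lt_log_natCast hn
  have hr0 : 0 ≤ r := le_trans (by positivity) hr
  have hA := hM.exp_clippedCov_le (by omega) hd hσ hP hr0 hκ hκσ j k
  have hB := hP.abs_integral_clip_sub_covMatrix_le (by omega) hσ hr0 j k
  set ρ := √(Real.log d / n) with hρ
  have hρ2 : n * ρ ^ 2 = Real.log d := by
    rw [hρ, Real.sq_sqrt (by positivity)]; field_simp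
  have hρ0 : 0 ≤ ρ := Real.sqrt_nonneg _
  set θ := κ * (n * ρ) with hθ
  have hθ0 : 0 ≤ θ := by positivity
  set m := ∫ y, clip r y j * clip r y k ∂P with hm
  have hnoise : ∀ s : ℝ, |s| = 1 → Real.exp (v.toNNReal * (s * θ) ^ 2 / 2) ≤ d := by
    intro s hs
    have hs2 : s ^ 2 = 1 := by rw [← sq_abs, hs]; norm_num
    rw [← Real.exp_log (show (0 : ℝ) < d by linarith), Real.exp_le_exp, mul_pow, hs2, one_mul]
    have e : θ ^ 2 = κ ^ 2 * n * Real.log d := by rw [hθ, ← hρ2]; ring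
    have h1 : κ ^ 2 * n * (v.toNNReal : ℝ) ≤ 2 := by
      rw [Real.coe_toNNReal']
      rcases le_total v 0 with h | h
      · rw [max_eq_right h]; norm_num
      · rwa [max_eq_left h]
    rw [e]
    nlinarith
  have hN : Integrable (fun ω => Real.exp (θ * |N j k ω|)) μ ∧
      ∫ ω, Real.exp (θ * |N j k ω|) ∂μ ≤ 2 * d := by
    have n1 := hM.exp_noise_le j k θ
    have n2 := hM.exp_noise_le j k (-θ)
    refine integrable_exp_mul_abs (hM.aemeasurable_noise j k).aestronglyMeasurable n1.1 n2.1
      (n1.2.le.trans ?_) (n2.2.le.trans ?_)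
    · simpa using hnoise 1 (by simp)
    · simpa using hnoise (-1) (by simp)
  -- r ≥ 2σ√(log n) bounds the bias by 16σ² n^(-1/2); after scaling this is at most √(log d) ≤ 2 log
  -- d, as log d > 1/2.
  have hbias : θ / 2 * |m - covMatrix P j k| ≤ 2 * Real.log d := by
    set b := Real.exp (-(Real.log n / 2)) with hb
    have hb0 : 0 < b := Real.exp_pos _
    have hbn : n * b ^ 2 = 1 := by
      rw [hb, ← Real.exp_nat_mul,
        show ((2 : ℕ) : ℝ) * -(Real.log n / 2) = -Real.log n by push_cast; ring,
        Real.exp_neg, Real.exp_log (by linarith)]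
      field_simp
    have hb1 : |m - covMatrix P j k| ≤ 16 * σ ^ 2 * b := by
      refine hB.trans ?_
      refine mul_le_mul_of_nonneg_left (Real.exp_le_exp.2 (neg_le_neg ?_)) (by positivity)
      rw [div_le_div_iff₀ (by norm_num) (by positivity)]
      have h4 : (2 * σ * √(Real.log n)) ^ 2 ≤ r ^ 2 := pow_le_pow_left₀ (by positivity) hr 2
      rw [mul_pow, Real.sq_sqrt (by linarith)] at h4
      nlinarith
    have h2 : (n * ρ * b) ^ 2 = Real.log d := by
      calc (n * ρ * b) ^ 2 = (n * ρ ^ 2) * (n * b ^ 2) := by ring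
        _ = _ := by rw [hρ2, hbn, mul_one]
    have h3 : n * ρ * b ≤ 2 * Real.log d := by
      apply le_of_sq_le_sq _ (by linarith)
      rw [h2]
      nlinarith
    calc θ / 2 * |m - covMatrix P j k| ≤ θ / 2 * (16 * σ ^ 2 * b) := by gcongr
      _ = (κ * (8 * σ ^ 2)) * (n * ρ * b) := by rw [hθ]; ring
      _ ≤ 1 * (n * ρ * b) := by gcongr
      _ ≤ _ := by linarith
  have hd2 : Real.exp (2 * Real.log d) = (d : ℝ) ^ 2 := by
    have := Real.exp_nat_mul (Real.log d) 2
    rw [Real.exp_log (by linarith)] at this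
    exact_mod_cast this
  have pt : ∀ ω, Real.exp (κ / 2 * (n * ρ) * |entryDev P r x N j k ω|) ≤
      (d : ℝ) ^ 2 * ((Real.exp (θ * |clippedCov r (fun i => x i ω) j k - m|) +
        Real.exp (θ * |N j k ω|)) / 2) := by
    intro ω
    set A := |clippedCov r (fun i => x i ω) j k - m|
    have h1 : |entryDev P r x N j k ω| ≤ A + |N j k ω| + |m - covMatrix P j k| := by
      rw [entryDev, show clippedCov r (fun i => x i ω) j k + N j k ω - covMatrix P j k =
        (clippedCov r (fun i => x i ω) j k - m) + N j k ω + (m - covMatrix P j k) by ring]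
      exact abs_add_three _ _ _
    have h2 : κ / 2 * (n * ρ) * |entryDev P r x N j k ω| ≤
        2 * Real.log d + (θ * A / 2 + θ * |N j k ω| / 2) := by
      have : κ / 2 * (n * ρ) = θ / 2 := by rw [hθ]; ring
      rw [this]
      nlinarith [mul_le_mul_of_nonneg_left h1 (show 0 ≤ θ / 2 by linarith)]
    have h3 : ∀ u : ℝ, Real.exp u = Real.exp (u / 2) ^ 2 := fun u => by
      rw [← Real.exp_nat_mul]; congr 1; push_cast; ring
    calc _ ≤ Real.exp (2 * Real.log d + (θ * A / 2 + θ * |N j k ω| / 2)) := Real.exp_le_exp.2 h2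
      _ = (d : ℝ) ^ 2 * (Real.exp (θ * A / 2) * Real.exp (θ * |N j k ω| / 2)) := by
        rw [Real.exp_add, Real.exp_add, hd2]
      _ ≤ _ := by
        gcongr
        rw [h3 (θ * A), h3 (θ * |N j k ω|)]
        nlinarith [sq_nonneg (Real.exp (θ * A / 2) - Real.exp (θ * |N j k ω| / 2))]
  have hdom := (((hA.1.add hN.1).div_const 2).const_mul ((d : ℝ) ^ 2))
  have hI : Integrable (fun ω => Real.exp (κ / 2 * (n * ρ) * |entryDev P r x N j k ω|)) μ := by
    refine hdom.mono ((Real.measurable_exp.comp_aemeasurable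
      ((measurable_norm.comp_aemeasurable
        (hM.aemeasurable_entryDev r j k)).const_mul _)).aestronglyMeasurable)
      (Filter.Eventually.of_forall fun ω => ?_)
    rw [Real.norm_eq_abs, Real.norm_eq_abs, Real.abs_exp]
    exact (pt ω).trans (le_abs_self _)
  refine ⟨hI, (integral_mono hI hdom pt).trans ?_⟩
  simp only [Pi.add_apply]
  rw [integral_const_mul, integral_div, integral_add hA.1 hN.1]
  calc (d : ℝ) ^ 2 * ((∫ ω, Real.exp (θ * |clippedCov r (fun i => x i ω) j k - m|) ∂μ +
        ∫ ω, Real.exp (θ * |N j k ω|) ∂μ) / 2) ≤ (d : ℝ) ^ 2 * ((2 * d + 2 * d) / 2) := by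
        gcongr
        · exact hA.2
        · exact hN.2
    _ = (d : ℝ) ^ 3 * 2 := by ring
    _ ≤ (d : ℝ) ^ 3 * d := by gcongr
    _ = _ := by ring

end Model

/-! ### Deterministic error of hard thresholding -/

theorem infNorm_le_of_row_sum_le {d : ℕ} {A : Matrix (Fin d) (Fin d) ℝ} {c : ℝ} (hc : 0 ≤ c)
    (h : ∀ i, ∑ j, |A i j| ≤ c) : infNorm A ≤ c := by
  refine ContinuousLinearMap.opNorm_le_bound _ hc fun y => ?_
  rw [pi_norm_le_iff_of_nonneg (by positivity)]
  intro i
  simp only [LinearMap.coe_toContinuousLinearMap', Matrix.mulVecLin_apply, Matrix.mulVec,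
    dotProduct]
  calc ‖∑ j, A i j * y j‖ ≤ ∑ j, ‖A i j * y j‖ := norm_sum_le _ _
    _ ≤ ∑ j, |A i j| * ‖y‖ := by
      refine Finset.sum_le_sum fun j _ => ?_
      rw [norm_mul, Real.norm_eq_abs]
      gcongr
      exact norm_le_pi_norm y j
    _ = (∑ j, |A i j|) * ‖y‖ := by rw [Finset.sum_mul]
    _ ≤ c * ‖y‖ := by gcongr; exact h i

theorem infNorm_nonneg {d : ℕ} (A : Matrix (Fin d) (Fin d) ℝ) : 0 ≤ infNorm A := norm_nonneg _

theorem continuous_infNorm_of (d : ℕ) :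
    Continuous fun a : Fin d → Fin d → ℝ => infNorm (Matrix.of a) := by
  let f : (Fin d → Fin d → ℝ) →ₗ[ℝ] ((Fin d → ℝ) →L[ℝ] (Fin d → ℝ)) :=
    { toFun := fun a => LinearMap.toContinuousLinearMap (Matrix.mulVecLin (Matrix.of a))
      map_add' := fun a b => by
        rw [← map_add, ← Matrix.mulVecLin_add]; rfl
      map_smul' := fun c a => by
        ext y i
        simp [Matrix.mulVec, dotProduct, Finset.mul_sum, mul_assoc] }
  exact continuous_norm.comp f.continuous_of_finiteDimensional

theorem abs_threshold_sub_le {t : ℝ} (ht : 0 ≤ t) (s D : ℝ) :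
    |(if t < |s + D| then s + D else 0) - s| ≤ t + |D| := by
  split_ifs with h
  · rw [add_sub_cancel_left]; linarith
  · rw [zero_sub, abs_neg]
    have : |s| ≤ |s + D| + |D| := by
      calc |s| = |s + D - D| := by rw [add_sub_cancel_right]
        _ ≤ _ := abs_sub _ _
    linarith

/-- A surviving entry has |s| > t/2 ≥ |D|, and its error is |D|. A killed one has error |s| ≤ t +
|D| ≤ 3t/2. -/
theorem abs_threshold_sub_le_min {t s D : ℝ} (hD : |D| ≤ t / 2) :
    |(if t < |s + D| then s + D else 0) - s| ≤ min |s| (3 / 2 * t) := by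
  have ht : 0 ≤ t := by linarith [abs_nonneg D]
  split_ifs with h
  · rw [add_sub_cancel_left]
    have : |s + D| ≤ |s| + |D| := abs_add_le _ _
    exact le_min (by linarith) (by linarith)
  · rw [zero_sub, abs_neg]
    have : |s| ≤ |s + D| + |D| := by
      calc |s| = |s + D - D| := by rw [add_sub_cancel_right]
        _ ≤ _ := abs_sub _ _
    exact le_min le_rfl (by linarith)

theorem le_rpow_mul_rpow_of_le_min {a b e q : ℝ} (he : 0 ≤ e) (hq : 0 ≤ q) (hq1 : q < 1)
    (h : e ≤ min |a| b) : e ≤ (if a = 0 then 0 else |a| ^ q) * b ^ (1 - q) := by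
  have h1 := h.trans (min_le_left _ _)
  have h2 := h.trans (min_le_right _ _)
  split_ifs with ha
  · simpa [ha] using h1
  · calc e = e ^ q * e ^ (1 - q) := by
          rw [← Real.rpow_add_of_nonneg he hq (by linarith)]; simp
      _ ≤ |a| ^ q * b ^ (1 - q) := by
          have := Real.rpow_le_rpow he h2 (show 0 ≤ 1 - q by linarith)
          have := Real.rpow_le_rpow he h1 hq
          gcongr

theorem infNorm_hardThreshold_sub_le {d : ℕ} {A D : Matrix (Fin d) (Fin d) ℝ} {t q s : ℝ}
    (hs : 0 ≤ s) (ht : 0 ≤ t) (hq : 0 ≤ q) (hq1 : q < 1) (hA : A ∈ SparseClass d q s)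
    (hD : ∀ i j, |D i j| ≤ t / 2) :
    infNorm (hardThreshold t (A + D) - A) ≤ s * (3 / 2 * t) ^ (1 - q) := by
  refine infNorm_le_of_row_sum_le (by positivity) fun i => ?_
  calc ∑ j, |(hardThreshold t (A + D) - A) i j|
      ≤ ∑ j, (if A i j = 0 then 0 else |A i j| ^ q) * (3 / 2 * t) ^ (1 - q) := by
        refine Finset.sum_le_sum fun j _ => ?_
        simp only [hardThreshold, Matrix.sub_apply, Matrix.of_apply, Matrix.add_apply]
        exact le_rpow_mul_rpow_of_le_min (abs_nonneg _) hq hq1 (abs_threshold_sub_le_min (hD i j))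
    _ = (∑ j, if A i j = 0 then 0 else |A i j| ^ q) * (3 / 2 * t) ^ (1 - q) := by
        rw [Finset.sum_mul]
    _ ≤ _ := by gcongr; exact hA i

theorem infNorm_hardThreshold_sub_le_mul {d : ℕ} {A D : Matrix (Fin d) (Fin d) ℝ} {t M : ℝ}
    (ht : 0 ≤ t) (hM : 0 ≤ M) (hD : ∀ i j, |D i j| ≤ M) :
    infNorm (hardThreshold t (A + D) - A) ≤ d * (t + M) := by
  refine infNorm_le_of_row_sum_le (by positivity) fun i => ?_
  calc ∑ j, |(hardThreshold t (A + D) - A) i j| ≤ ∑ _j : Fin d, (t + M) := by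
        refine Finset.sum_le_sum fun j _ => ?_
        simp only [hardThreshold, Matrix.sub_apply, Matrix.of_apply, Matrix.add_apply]
        exact (abs_threshold_sub_le ht _ _).trans (by linarith [hD i j])
    _ = d * (t + M) := by simp [mul_add]

/-- Half of the exponent θM pays for the polynomial growth of M²; the other half, being at least
θτ/2, supplies the small factor. -/
theorem sq_add_le_exp_mul_exp {T M θ τ : ℝ} (hθ : 0 < θ) (hτ : 0 ≤ τ) (h : τ ≤ M) :
    (T + M) ^ 2 ≤ (2 * T ^ 2 + 16 / θ ^ 2) * (Real.exp (-(θ * τ / 2)) * Real.exp (θ * M)) := by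
  rw [← Real.exp_add]
  have hMτ : θ * τ ≤ θ * M := by gcongr
  have hτ0 : 0 ≤ θ * τ := by positivity
  have h1 : 1 ≤ Real.exp (-(θ * τ / 2) + θ * M) := Real.one_le_exp (by linarith)
  have h2 : Real.exp (θ * M / 2) ≤ Real.exp (-(θ * τ / 2) + θ * M) :=
    Real.exp_le_exp.2 (by linarith)
  have h3 : M ^ 2 ≤ 8 / θ ^ 2 * Real.exp (θ * M / 2) := by
    have := Real.quadratic_le_exp_of_nonneg (show 0 ≤ θ * M / 2 by linarith)
    rw [div_mul_eq_mul_div, le_div_iff₀ (by positivity)]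
    nlinarith
  calc (T + M) ^ 2 ≤ 2 * T ^ 2 * 1 + 2 * M ^ 2 := by nlinarith [sq_nonneg (T - M)]
    _ ≤ 2 * T ^ 2 * Real.exp (-(θ * τ / 2) + θ * M) +
        2 * (8 / θ ^ 2 * Real.exp (-(θ * τ / 2) + θ * M)) := by
        gcongr
        exact h3.trans (by gcongr)
    _ = _ := by ring

/-- A pointwise bound on the squared error of hard thresholding: the minimax rate plus an
exponential penalty for large entrywise deviations. -/
theorem sq_infNorm_hardThreshold_sub_le {d : ℕ} {A D : Matrix (Fin d) (Fin d) ℝ}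
    {t q s θ τ : ℝ} (hs : 0 ≤ s) (hq : 0 ≤ q) (hq1 : q < 1)
    (hA : A ∈ SparseClass d q s) (hθ : 0 < θ) (hτ : 0 ≤ τ) (hτt : τ ≤ t / 2) :
    infNorm (hardThreshold t (A + D) - A) ^ 2 ≤ s ^ 2 * (9 / 4 * t ^ 2) ^ (1 - q) +
      d ^ 2 * ((2 * t ^ 2 + 16 / θ ^ 2) * Real.exp (-(θ * τ / 2))) *
        ∑ i, ∑ j, Real.exp (θ * |D i j|) := by
  have ht : 0 ≤ t := by linarith
  have hS : 0 ≤ ∑ i, ∑ j, Real.exp (θ * |D i j|) := by positivity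
  by_cases hD : ∀ i j, |D i j| ≤ t / 2
  · have h1 := infNorm_hardThreshold_sub_le hs ht hq hq1 hA hD
    have h2 := pow_le_pow_left₀ (infNorm_nonneg _) h1 2
    have h3 : (s * (3 / 2 * t) ^ (1 - q)) ^ 2 = s ^ 2 * (9 / 4 * t ^ 2) ^ (1 - q) := by
      rw [mul_pow, show (9 : ℝ) / 4 * t ^ 2 = (3 / 2 * t) * (3 / 2 * t) by ring,
        Real.mul_rpow (x := 3 / 2 * t) (y := 3 / 2 * t) (by positivity) (by positivity)]
      ring
    rw [h3] at h2
    exact h2.trans (le_add_of_nonneg_right (by positivity))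
  · push Not at hD
    obtain ⟨i₀, j₀, h0⟩ := hD
    obtain ⟨p, -, hp⟩ := Finset.exists_max_image (Finset.univ : Finset (Fin d × Fin d))
      (fun p => |D p.1 p.2|) ⟨(i₀, j₀), Finset.mem_univ _⟩
    have hmax : ∀ i j, |D i j| ≤ |D p.1 p.2| := fun i j => hp (i, j) (Finset.mem_univ _)
    have h1 := infNorm_hardThreshold_sub_le_mul (A := A) ht (abs_nonneg _) hmax
    have h2 := pow_le_pow_left₀ (infNorm_nonneg _) h1 2
    have h3 := sq_add_le_exp_mul_exp (T := t) hθ hτ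
      (show τ ≤ |D p.1 p.2| by linarith [hmax i₀ j₀])
    have h4 : Real.exp (θ * |D p.1 p.2|) ≤ ∑ i, ∑ j, Real.exp (θ * |D i j|) := by
      refine le_trans ?_ (Finset.single_le_sum (f := fun i => ∑ j, Real.exp (θ * |D i j|))
        (fun i _ => by positivity) (Finset.mem_univ p.1))
      exact Finset.single_le_sum (f := fun j => Real.exp (θ * |D p.1 j|))
        (fun i _ => by positivity) (Finset.mem_univ p.2)
    refine h2.trans (le_trans ?_ (le_add_of_nonneg_left (by positivity)))
    calc (d * (t + |D p.1 p.2|)) ^ 2 = d ^ 2 * (t + |D p.1 p.2|) ^ 2 := by ring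
      _ ≤ d ^ 2 * ((2 * t ^ 2 + 16 / θ ^ 2) *
          (Real.exp (-(θ * τ / 2)) * Real.exp (θ * |D p.1 p.2|))) := by gcongr
      _ ≤ d ^ 2 * ((2 * t ^ 2 + 16 / θ ^ 2) *
          (Real.exp (-(θ * τ / 2)) * ∑ i, ∑ j, Real.exp (θ * |D i j|))) := by gcongr
      _ = _ := by ring

/-! ### From the pointwise bound to risk and probability -/

/-- Markov's inequality for S at level D^(m+1): the one spare factor D is the failure probability
1/D. -/
theorem integrable_and_prob_of_le_add_mul {Ω : Type*} [MeasurableSpace Ω] {μ : Measure Ω}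
    [IsProbabilityMeasure μ] {E S : Ω → ℝ} {a b c D : ℝ} {m : ℕ} (hE : AEStronglyMeasurable E μ)
    (hE0 : ∀ ω, 0 ≤ E ω) (hS0 : ∀ ω, 0 ≤ S ω) (hle : ∀ ω, E ω ≤ a + b * S ω)
    (hS : Integrable S μ) (hb : 0 ≤ b) (hD : 1 ≤ D) (hSD : ∫ ω, S ω ∂μ ≤ D ^ m)
    (hbc : b * D ^ (m + 1) ≤ c) :
    (Integrable E μ ∧ ∫ ω, E ω ∂μ ≤ a + c) ∧
      1 - D ^ (-1 : ℝ) ≤ μ.real {ω | E ω ≤ a + c} := by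
  have hD0 : 0 < D := by linarith
  have hdom : Integrable (fun ω => a + b * S ω) μ := (integrable_const a).add (hS.const_mul b)
  have hI : Integrable E μ := by
    refine hdom.mono hE (Filter.Eventually.of_forall fun ω => ?_)
    rw [Real.norm_eq_abs, Real.norm_eq_abs, abs_of_nonneg (hE0 ω)]
    exact (hle ω).trans (le_abs_self _)
  refine ⟨⟨hI, (integral_mono hI hdom hle).trans ?_⟩, ?_⟩
  · rw [integral_add (integrable_const a) (hS.const_mul b), integral_const_mul]
    have h1 : D ^ m ≤ D ^ (m + 1) := pow_le_pow_right₀ hD (by omega)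
    have h2 := mul_le_mul_of_nonneg_left (hSD.trans h1) hb
    simp
    linarith
  · have hM := mul_meas_ge_le_integral_of_nonneg (Filter.Eventually.of_forall hS0) hS (D ^ (m + 1))
    have h1 : μ.real {ω | D ^ (m + 1) ≤ S ω} ≤ D ^ (-1 : ℝ) := by
      rw [Real.rpow_neg_one, ← one_div, le_div_iff₀ hD0]
      have h2 := hM.trans hSD
      rw [pow_succ, mul_assoc] at h2
      have h3 : 0 < D ^ m := by positivity
      have h4 : D ^ m * (D * μ.real {ω | D ^ (m + 1) ≤ S ω}) ≤ D ^ m * 1 := by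
        simpa [pow_succ] using h2
      have := le_of_mul_le_mul_left h4 h3
      linarith
    have hsub : Set.univ ⊆ {ω | E ω ≤ a + c} ∪ {ω | D ^ (m + 1) ≤ S ω} := by
      intro ω _
      by_cases h : D ^ (m + 1) ≤ S ω
      · exact Or.inr h
      · left
        have := mul_le_mul_of_nonneg_left (not_le.1 h).le hb
        have := hle ω
        change E ω ≤ a + c
        linarith
    have h2 := (measureReal_mono (μ := μ) hsub).trans (measureReal_union_le _ _)
    rw [probReal_univ] at h2
    linarith

theorem SamplingModel.aestronglyMeasurable_sqError {Ω : Type*} [MeasurableSpace Ω] {μ : Measure Ω}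
    {n d : ℕ} {P : Measure (EuclideanSpace ℝ (Fin d))} {v : ℝ}
    {x : Fin n → Ω → EuclideanSpace ℝ (Fin d)} {N : Fin d → Fin d → Ω → ℝ}
    (hM : SamplingModel μ P v x N) (γ r ε δ : ℝ) :
    AEStronglyMeasurable (sqError P γ r ε δ x N) μ := by
  have h : AEMeasurable (fun ω j k =>
      (privCov γ r ε δ (fun i => x i ω) (Matrix.of fun i j => N i j ω) - covMatrix P) j k) μ := by
    refine aemeasurable_pi_lambda _ fun j => aemeasurable_pi_lambda _ fun k => ?_
    simp only [privCov, hardThreshold, Matrix.sub_apply, Matrix.of_apply, Matrix.add_apply]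
    have hm : Measurable fun y : ℝ => if thres n d γ r ε δ < |y| then y else 0 :=
      Measurable.ite (measurableSet_lt measurable_const measurable_norm) measurable_id
        measurable_const
    exact (hm.comp_aemeasurable
      ((hM.aemeasurable_clippedCov r j k).add (hM.aemeasurable_noise j k))).sub_const _
  exact (((continuous_infNorm_of d).measurable.comp_aemeasurable h).pow_const 2).aestronglyMeasurable

/-- The risk bound for the thresholded estimator, with the exponential moments of the entries
of `Σ̇ - Σ` as input. -/
theorem SamplingModel.sqError_bounds {Ω : Type*} [MeasurableSpace Ω] {μ : Measure Ω}
    [IsProbabilityMeasure μ] {n d : ℕ} {P : Measure (EuclideanSpace ℝ (Fin d))} {v : ℝ}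
    {x : Fin n → Ω → EuclideanSpace ℝ (Fin d)} {N : Fin d → Fin d → Ω → ℝ}
    (hM : SamplingModel μ P v x N) {γ r ε δ q s θ τ c : ℝ} (hd : 0 < d)
    (hq : 0 ≤ q) (hq1 : q < 1) (hA : covMatrix P ∈ SparseClass d q s) (hθ : 0 < θ) (hτ : 0 ≤ τ)
    (hτt : τ ≤ thres n d γ r ε δ / 2)
    (hdev : ∀ j k, Integrable (fun ω => Real.exp (θ * |entryDev P r x N j k ω|)) μ ∧
      ∫ ω, Real.exp (θ * |entryDev P r x N j k ω|) ∂μ ≤ (d : ℝ) ^ 4)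
    (hexp : Real.exp (-(θ * τ / 2)) * (d : ℝ) ^ 9 ≤ 1)
    (hc : 2 * thres n d γ r ε δ ^ 2 + 16 / θ ^ 2 ≤ c) :
    (Integrable (sqError P γ r ε δ x N) μ ∧
      ∫ ω, sqError P γ r ε δ x N ω ∂μ ≤
        s ^ 2 * (9 / 4 * thres n d γ r ε δ ^ 2) ^ (1 - q) + c) ∧
    1 - (d : ℝ) ^ (-1 : ℝ) ≤ μ.real {ω | sqError P γ r ε δ x N ω ≤
        s ^ 2 * (9 / 4 * thres n d γ r ε δ ^ 2) ^ (1 - q) + c} := by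
  have hd1 : (1 : ℝ) ≤ d := by exact_mod_cast hd
  have hs : 0 ≤ s := by
    refine le_trans (Finset.sum_nonneg fun j _ => ?_) (hA ⟨0, hd⟩)
    split_ifs
    · exact le_rfl
    · positivity
  set t := thres n d γ r ε δ with ht
  have hi : ∀ j, Integrable (fun ω => ∑ k, Real.exp (θ * |entryDev P r x N j k ω|)) μ :=
    fun j => integrable_finsetSum _ fun k _ => (hdev j k).1
  -- Powers of d: d² entries of moment d^4 give m = 6; with the d² in `b` and the spare factor for
  -- Markov's inequality the total is d^9, as in `hexp`.
  refine integrable_and_prob_of_le_add_mul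
    (S := fun ω => ∑ j, ∑ k, Real.exp (θ * |entryDev P r x N j k ω|)) (m := 6)
    (b := d ^ 2 * ((2 * t ^ 2 + 16 / θ ^ 2) * Real.exp (-(θ * τ / 2))))
    (hM.aestronglyMeasurable_sqError γ r ε δ) (fun ω => sq_nonneg _)
    (fun ω => by positivity) (fun ω => ?_) (integrable_finsetSum _ fun j _ => hi j)
    (by positivity) hd1 ?_ ?_
  · have h := sq_infNorm_hardThreshold_sub_le (A := covMatrix P)
      (D := Matrix.of fun j k => entryDev P r x N j k ω) (t := t) hs hq hq1 hA hθ hτ hτt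
    have e : covMatrix P + Matrix.of (fun j k => entryDev P r x N j k ω) =
        clippedCov r (fun i => x i ω) + Matrix.of fun i j => N i j ω := by
      ext j k
      simp [entryDev]
    rw [e] at h
    exact h
  · rw [integral_finsetSum _ fun j _ => hi j]
    calc _ ≤ ∑ _j : Fin d, ∑ _k : Fin d, (d : ℝ) ^ 4 := by
          refine Finset.sum_le_sum fun j _ => ?_
          rw [integral_finsetSum _ fun k _ => (hdev j k).1]
          exact Finset.sum_le_sum fun k _ => (hdev j k).2
      _ = (d : ℝ) ^ 6 := by simp; ring
  · calc _ = (2 * t ^ 2 + 16 / θ ^ 2) * (Real.exp (-(θ * τ / 2)) * (d : ℝ) ^ 9) := by ring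
      _ ≤ (2 * t ^ 2 + 16 / θ ^ 2) * 1 := by gcongr
      _ ≤ c := by linarith

/-! ### Comparison of the parameters with the base rate -/

theorem log_div_le {δ ℓ b : ℝ} (hδ : 0 < δ) (hℓ : 0 < ℓ) (h : ℓ ≤ Real.log (1 / δ)) (hb : 0 < b)
    (hb3 : b ≤ 3) : Real.log (b / δ) ≤ (1 + 2 / ℓ) * Real.log (1 / δ) := by
  have e : Real.log (b / δ) = Real.log b + Real.log (1 / δ) := by
    rw [← Real.log_mul hb.ne' (by positivity)]; congr 1; ring
  have h1 : Real.log b ≤ 2 := by linarith [Real.log_le_sub_one_of_pos hb]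
  have h2 : 2 ≤ 2 / ℓ * Real.log (1 / δ) := by
    calc (2 : ℝ) = 2 / ℓ * ℓ := by field_simp
      _ ≤ _ := by gcongr
  rw [e]
  linarith

theorem noiseVar_mul_le {n : ℕ} {r ε δ ℓ K : ℝ} (hn : 0 < n) (hε : 0 < ε) (hδ : 0 < δ)
    (hℓ : 0 < ℓ) (h : ℓ ≤ Real.log (1 / δ)) (hK : r ^ 4 * Real.log (1 / δ) / ε ^ 2 ≤ K * n) :
    n * noiseVar n r ε δ ≤ 32 * ((1 + 2 / ℓ) * K) := by
  have hn' : (0 : ℝ) < n := by exact_mod_cast hn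
  have h1 := log_div_le hδ hℓ h (b := 2.5) (by norm_num) (by norm_num)
  have hr4 : 0 ≤ r ^ 4 := by positivity
  calc n * noiseVar n r ε δ = 32 * (r ^ 4 / ε ^ 2) * Real.log (2.5 / δ) / n := by
        rw [noiseVar]; field_simp
    _ ≤ 32 * (r ^ 4 / ε ^ 2) * ((1 + 2 / ℓ) * Real.log (1 / δ)) / n := by gcongr
    _ = 32 * ((1 + 2 / ℓ) * (r ^ 4 * Real.log (1 / δ) / ε ^ 2)) / n := by ring
    _ ≤ 32 * ((1 + 2 / ℓ) * (K * n)) / n := by gcongr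
    _ = _ := by field_simp

theorem thres_sq_le {n d : ℕ} {γ r ε δ ℓ : ℝ} (hn : 0 < n) (hd : 2 ≤ d)
    (hε : 0 < ε) (hδ : 0 < δ) (hδ1 : δ < 1) (hℓ : 0 < ℓ) (h : ℓ ≤ Real.log (1 / δ)) :
    thres n d γ r ε δ ^ 2 ≤ 2 * γ ^ 2 * √(Real.log d / n) ^ 2 +
      64 * (1 + 2 / ℓ) * baseRate n d r ε δ := by
  have hn' : (1 : ℝ) ≤ n := by exact_mod_cast hn
  have hL := half_lt_log_natCast hd
  have h1 := log_div_le hδ hℓ h (b := 1.25) (by norm_num) (by norm_num)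
  have h0 : 0 ≤ Real.log (1.25 / δ) := by
    apply Real.log_nonneg
    rw [le_div_iff₀ hδ]
    linarith
  set T := 4 * r ^ 2 * √(2 * Real.log (1.25 / δ)) * √(Real.log d) / (n * ε) with hT
  have hT2 : T ^ 2 = 32 * (r ^ 4 * Real.log d / (n * ε ^ 2)) * Real.log (1.25 / δ) / n := by
    rw [hT, div_pow, mul_pow, mul_pow, Real.sq_sqrt (by linarith), Real.sq_sqrt (by linarith)]
    field_simp
    ring
  have hr4 : 0 ≤ r ^ 4 := by positivity
  have hlog : 0 ≤ Real.log (1 / δ) := by linarith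
  have hT3 : T ^ 2 ≤ 32 * (1 + 2 / ℓ) * baseRate n d r ε δ := by
    have hB : 0 ≤ baseRate n d r ε δ := by rw [baseRate]; positivity
    calc T ^ 2 ≤ 32 * (r ^ 4 * Real.log d / (n * ε ^ 2)) * ((1 + 2 / ℓ) * Real.log (1 / δ)) / n := by
          rw [hT2]; gcongr
      _ = 32 * (1 + 2 / ℓ) * baseRate n d r ε δ / n := by rw [baseRate]; ring
      _ ≤ _ := div_le_self (by positivity) hn'
  rw [thres, ← hT]
  nlinarith [sq_nonneg (γ * √(Real.log d / n) - T)]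

/-- The sampling scale log d / n is dominated by B because r^4 log(1/δ)/ε² is bounded below: log n >
1/2 gives r^4 ≥ 4σ^4. -/
theorem sq_le_baseRate {n d : ℕ} {σ r ε ε₀ δ ℓ : ℝ} (hn : 2 ≤ n) (hd : 2 ≤ d) (hσ : 0 < σ)
    (hε : 0 < ε) (hε₀ : ε ≤ ε₀) (hℓ : 0 < ℓ) (h : ℓ ≤ Real.log (1 / δ))
    (hr : 2 * σ * √(Real.log n) ≤ r) :
    4 * ℓ * σ ^ 4 / ε₀ ^ 2 * √(Real.log d / n) ^ 2 ≤ baseRate n d r ε δ := by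
  have hn' : (2 : ℝ) ≤ n := by exact_mod_cast hn
  have hL := half_lt_log_natCast hd
  have hLn := half_lt_log_natCast hn
  have hr4 : 4 * σ ^ 4 ≤ r ^ 4 := by
    have h4 := pow_le_pow_left₀ (by positivity) hr 4
    have e : (2 * σ * √(Real.log n)) ^ 4 = 16 * σ ^ 4 * Real.log n ^ 2 := by
      have := Real.sq_sqrt (show 0 ≤ Real.log n by linarith)
      calc (2 * σ * √(Real.log n)) ^ 4 = 16 * σ ^ 4 * (√(Real.log n) ^ 2) ^ 2 := by ring
        _ = _ := by rw [this]
    rw [e] at h4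
    have : 1 / 4 ≤ Real.log n ^ 2 := by nlinarith
    nlinarith [pow_pos hσ 4]
  rw [Real.sq_sqrt (by positivity), baseRate]
  calc 4 * ℓ * σ ^ 4 / ε₀ ^ 2 * (Real.log d / n)
      = ℓ * (4 * σ ^ 4) / ε₀ ^ 2 * (Real.log d / n) := by ring
    _ ≤ Real.log (1 / δ) * r ^ 4 / ε ^ 2 * (Real.log d / n) := by
        have : 0 ≤ Real.log (1 / δ) := by linarith
        gcongr
    _ = _ := by ring

theorem mul_rpow_le_one_add_mul_rpow {c b p : ℝ} (hc : 0 ≤ c) (hb : 0 ≤ b) (hp : 0 ≤ p)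
    (hp1 : p ≤ 1) : (c * b) ^ p ≤ (1 + c) * b ^ p := by
  rw [Real.mul_rpow hc hb]
  gcongr
  calc c ^ p ≤ (1 + c) ^ p := Real.rpow_le_rpow hc (by linarith) hp
    _ ≤ (1 + c) ^ (1 : ℝ) := Real.rpow_le_rpow_of_exponent_le (by linarith) hp1
    _ = 1 + c := Real.rpow_one _

theorem sixteen_div_sq_le {κ b₀ ρ y B : ℝ} (hκ : 0 < κ) (hb₀ : 0 < b₀) (hρ : 0 < ρ)
    (hy : 1 / 2 ≤ y * ρ ^ 2) (hρB : ρ ^ 2 ≤ B / b₀) :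
    16 / (κ / 2 * (y * ρ)) ^ 2 ≤ 256 / (κ ^ 2 * b₀) * B := by
  have hy0 : 0 < y := pos_of_mul_pos_left (by linarith) (sq_nonneg ρ)
  have h1 : 1 ≤ 4 * (y * ρ ^ 2) ^ 2 := by nlinarith
  calc 16 / (κ / 2 * (y * ρ)) ^ 2 ≤ 256 / κ ^ 2 * ρ ^ 2 := by
        rw [div_le_iff₀ (by positivity),
          show 256 / κ ^ 2 * ρ ^ 2 * (κ / 2 * (y * ρ)) ^ 2 = 64 * (y * ρ ^ 2) ^ 2 by
            field_simp; ring]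
        linarith
    _ ≤ 256 / κ ^ 2 * (B / b₀) := by gcongr
    _ = _ := by field_simp

/-- The exponent equals -(γκ/8) log d, so 72 = 8 · 9 is what cancels d^9. -/
theorem exp_mul_pow_nine_le_one {d y ρ κ γ : ℝ} (hd : 1 ≤ d) (hρ : y * ρ ^ 2 = Real.log d)
    (hγ : 72 ≤ γ * κ) :
    Real.exp (-(κ / 2 * (y * ρ) * (γ / 2 * ρ) / 2)) * d ^ 9 ≤ 1 := by
  have h9 : d ^ 9 = Real.exp (9 * Real.log d) := by
    have := Real.exp_nat_mul (Real.log d) 9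
    rw [Real.exp_log (by linarith)] at this
    exact_mod_cast this.symm
  rw [h9, ← Real.exp_add, Real.exp_le_one_iff,
    show κ / 2 * (y * ρ) * (γ / 2 * ρ) / 2 = γ * κ / 8 * (y * ρ ^ 2) by ring, hρ]
  nlinarith [Real.log_nonneg hd]

/-- Bounding c^(1-q) by 1 + c keeps the constant uniform in q. -/
theorem rate_le {q B C₁ C₂ T : ℝ} (s : ℝ) (hq : 0 ≤ q) (hq1 : q < 1) (hB : 0 ≤ B) (hC₁ : 0 ≤ C₁)
    (hC₂ : 0 ≤ C₂) (hT : T ^ 2 ≤ C₁ * B) :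
    s ^ 2 * (9 / 4 * T ^ 2) ^ (1 - q) + C₂ * B ≤
      (1 + 9 / 4 * C₁ + C₂) * (s ^ 2 * B ^ (1 - q) + B) := by
  have h1 : (9 / 4 * T ^ 2) ^ (1 - q) ≤ (1 + 9 / 4 * C₁) * B ^ (1 - q) := by
    refine le_trans (Real.rpow_le_rpow (by positivity) ?_ (by linarith))
      (mul_rpow_le_one_add_mul_rpow (by positivity) hB (by linarith) (by linarith))
    linarith
  have h2 : 0 ≤ s ^ 2 * B ^ (1 - q) := by positivity
  have h3 := mul_le_mul_of_nonneg_left h1 (sq_nonneg s)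
  have h4 := mul_nonneg hC₂ h2
  have h5 : 0 ≤ (1 + 9 / 4 * C₁) * B := by positivity
  linarith

end PrivCov

/-! ### Choice of the constants -/

theorem mainTheorem5 :
    ∃ c : ℝ, 0 < c ∧ ∃ a₀ : ℝ, 0 < a₀ ∧
    ∀ σ ε₀ δ₀ K : ℝ, 0 < σ → 0 < ε₀ → δ₀ < 1 → 0 < K →
    ∃ γ₀ : ℝ, 0 < γ₀ ∧ ∀ γ : ℝ, γ₀ ≤ γ →
    ∃ C : ℝ, 0 < C ∧
    ∀ (n d : ℕ) (q s r ε δ : ℝ), 2 ≤ n → 2 ≤ d →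
      0 ≤ q → q < 1 →
      0 < ε → ε ≤ ε₀ → 0 < δ → δ ≤ δ₀ →
      a₀ * σ * Real.sqrt (Real.log n) ≤ r →
      r ^ 4 * Real.log (1 / δ) / ε ^ 2 ≤ K * n →
    ∀ (Ω : Type*) [MeasurableSpace Ω] (μ : Measure Ω) [IsProbabilityMeasure μ]
      (P : Measure (EuclideanSpace ℝ (Fin d)))
      (x : Fin n → Ω → EuclideanSpace ℝ (Fin d)) (N : Fin d → Fin d → Ω → ℝ),
      PrivCov.SamplingModel μ P (PrivCov.noiseVar n r ε δ) x N →
      PrivCov.IsSubGaussianLaw P (σ ^ 2 / d).toNNReal →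
      PrivCov.covMatrix P ∈ PrivCov.SparseClass d q s →
      (Integrable (PrivCov.sqError P γ r ε δ x N) μ ∧
        ∫ ω, PrivCov.sqError P γ r ε δ x N ω ∂μ ≤
          C * (s ^ 2 * PrivCov.baseRate n d r ε δ ^ (1 - q) + PrivCov.baseRate n d r ε δ)) ∧
      1 - (d : ℝ) ^ (-c) ≤
        μ.real {ω | PrivCov.sqError P γ r ε δ x N ω ≤
          C * (s ^ 2 * PrivCov.baseRate n d r ε δ ^ (1 - q) + PrivCov.baseRate n d r ε δ)} := by
  refine ⟨1, one_pos, 2, two_pos, fun σ ε₀ δ₀ K hσ hε₀ hδ₀ hK => ?_⟩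
  -- δ₀ may be nonpositive; the maximum keeps log(1/δ₁) a genuine positive lower bound for log(1/δ).
  set δ₁ := max δ₀ (1 / 2) with hδ₁
  have hδ₁0 : 0 < δ₁ := lt_of_lt_of_le (by norm_num) (le_max_right _ _)
  have hδ₁1 : δ₁ < 1 := max_lt hδ₀ (by norm_num)
  obtain ⟨ℓ, hℓ, hℓδ⟩ : ∃ ℓ, 0 < ℓ ∧ ℓ = Real.log (1 / δ₁) :=
    ⟨_, Real.log_pos ((one_lt_div hδ₁0).2 hδ₁1), rfl⟩
  obtain ⟨Λ, hΛ, hΛℓ⟩ : ∃ Λ, 0 < Λ ∧ Λ = 1 + 2 / ℓ := ⟨_, by positivity, rfl⟩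
  -- The three summands give in turn κ · 8σ² ≤ 1 (sampling), κ · 16ΛK ≤ 1 and κ ≤ 1; the last two
  -- yield κ² · 32ΛK ≤ 2 (noise).
  obtain ⟨κ, hκ, hκ1⟩ : ∃ κ, 0 < κ ∧ κ * (8 * σ ^ 2 + 16 * (Λ * K) + 1) = 1 :=
    ⟨1 / (8 * σ ^ 2 + 16 * (Λ * K) + 1), by positivity, by field_simp⟩
  have hΛK : 0 < Λ * K := by positivity
  have hκσ : κ * (8 * σ ^ 2) ≤ 1 := by nlinarith
  have hκle : κ ≤ 1 := by nlinarith [mul_pos hκ (pow_pos hσ 2), mul_pos hκ hΛK]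
  have hκK : κ * (16 * (Λ * K)) ≤ 1 := by nlinarith [mul_pos hκ (pow_pos hσ 2)]
  refine ⟨72 / κ, by positivity, fun γ hγ => ?_⟩
  rw [div_le_iff₀ hκ] at hγ
  have hγ0 : 0 < γ := pos_of_mul_pos_left (by linarith) hκ.le
  obtain ⟨b₀, hb₀, hb₀e⟩ : ∃ b₀, 0 < b₀ ∧ b₀ = 4 * ℓ * σ ^ 4 / ε₀ ^ 2 := ⟨_, by positivity, rfl⟩
  obtain ⟨C₁, hC₁, hC₁e⟩ : ∃ C₁, 0 < C₁ ∧ C₁ = 2 * γ ^ 2 / b₀ + 64 * Λ := ⟨_, by positivity, rfl⟩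
  obtain ⟨C₂, hC₂, hC₂e⟩ : ∃ C₂, 0 < C₂ ∧ C₂ = 2 * C₁ + 256 / (κ ^ 2 * b₀) :=
    ⟨_, by positivity, rfl⟩
  refine ⟨1 + 9 / 4 * C₁ + C₂, by positivity, ?_⟩
  intro n d q s r ε δ hn hd hq hq1 hε hεε₀ hδ hδδ₀ hr hrK Ω _ μ _ P x N hM hP hA
  have hn' : (2 : ℝ) ≤ n := by exact_mod_cast hn
  have hd' : (2 : ℝ) ≤ d := by exact_mod_cast hd
  have hPp : IsProbabilityMeasure P :=
    (hM.record_law ⟨0, by omega⟩).isProbabilityMeasure_iff.1 inferInstance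
  have hℓle : ℓ ≤ Real.log (1 / δ) := by
    rw [hℓδ]
    have : δ ≤ δ₁ := hδδ₀.trans (le_max_left _ _)
    gcongr
  have hL := PrivCov.half_lt_log_natCast hd
  have hκv : κ ^ 2 * n * PrivCov.noiseVar n r ε δ ≤ 2 := by
    have h1 := PrivCov.noiseVar_mul_le (by omega) hε hδ hℓ hℓle hrK
    rw [← hΛℓ] at h1
    calc κ ^ 2 * n * PrivCov.noiseVar n r ε δ = κ ^ 2 * (n * PrivCov.noiseVar n r ε δ) := by ring
      _ ≤ κ ^ 2 * (32 * (Λ * K)) := by gcongr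
      _ = 2 * (κ * (κ * (16 * (Λ * K)))) := by ring
      _ ≤ 2 * (1 * 1) := by gcongr
      _ = 2 := by norm_num
  have hdev := hM.exp_entryDev_le hn hd hσ hP hr hκ hκσ hκv
  have hT := PrivCov.thres_sq_le (γ := γ) (r := r) (show 0 < n by omega) hd hε hδ
    (lt_of_le_of_lt hδδ₀ hδ₀) hℓ hℓle
  have hB := PrivCov.sq_le_baseRate hn hd hσ hε hεε₀ hℓ hℓle hr
  have hτ : γ / 2 * √(Real.log d / n) ≤ PrivCov.thres n d γ r ε δ / 2 := by
    rw [PrivCov.thres]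
    have : 0 ≤ 4 * r ^ 2 * √(2 * Real.log (1.25 / δ)) * √(Real.log d) / (n * ε) := by positivity
    linarith
  rw [← hΛℓ] at hT
  rw [← hb₀e] at hB
  set B := PrivCov.baseRate n d r ε δ with hBe
  set ρ := √(Real.log d / n) with hρ
  set T := PrivCov.thres n d γ r ε δ with hTe
  have hρ0 : 0 < ρ := Real.sqrt_pos.2 (by positivity)
  have hρ2 : n * ρ ^ 2 = Real.log d := by
    rw [hρ, Real.sq_sqrt (by positivity)]; field_simp
  have hB0 : 0 ≤ B := le_trans (by positivity) hB
  have hρB : ρ ^ 2 ≤ B / b₀ := by rw [le_div_iff₀ hb₀]; linarith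
  have hTB : T ^ 2 ≤ C₁ * B := by
    calc T ^ 2 ≤ 2 * γ ^ 2 * ρ ^ 2 + 64 * Λ * B := hT
      _ ≤ 2 * γ ^ 2 * (B / b₀) + 64 * Λ * B := by gcongr
      _ = C₁ * B := by rw [hC₁e]; ring
  set θ := κ / 2 * (n * ρ) with hθe
  have hθ : 0 < θ := by positivity
  have hθB := PrivCov.sixteen_div_sq_le hκ hb₀ hρ0 (show 1 / 2 ≤ (n : ℝ) * ρ ^ 2 by linarith) hρB
  have hexp := PrivCov.exp_mul_pow_nine_le_one (by linarith) hρ2 hγ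
  have main := hM.sqError_bounds (c := C₂ * B) (by omega) hq hq1 hA hθ (by positivity) hτ hdev hexp
    (by rw [hC₂e]; linarith)
  have hfin := PrivCov.rate_le s hq hq1 hB0 hC₁.le hC₂.le hTB
  exact ⟨⟨main.1.1, main.1.2.trans hfin⟩,
    main.2.trans (measureReal_mono fun ω hω => le_trans hω hfin)⟩
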